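/- Let $A$, $A'$, $R$ be quantum systems described by arbitrary complex Hilbert spaces $\mathcal H_A,\mathcal H_{A'},\mathcal H_R$ (finite- or infinite-dimensional). A test for probabilistic devices consists of a joint input state $\sigma_{AR}$ (a positive operator of trace one on $\mathcal H_A\otimes\mathcal H_R$) and a bounded self-adjoint observable $O$ on $\mathcal H_{A'}\otimes\mathcal H_R$. Its marginal input state is $\sigma_A=\mathrm{Tr}_R[\sigma_{AR}]$, and its performance operator is the bounded operator $\Omega=\mathrm{Tr}_R[(O_{A'R}\otimes I_A)(I_{A'}\otimes\sigma_{AR})]$ on $\mathcal H_{A'}\otimes\mathcal H_A$, i.e. $\langle x\otimes a|\Omega|y\otimes b\rangle=\mathrm{Tr}_R\big[\langle x|O|y\rangle\,\langle a|\sigma_{AR}|b\rangle\big]$ for all $x,y\in\mathcal H_{A'}$, $a,b\in\mathcal H_A$. A probabilistic measure-and-prepare device is a map $\mathcal C(\rho)=\sum_k \mathrm{Tr}[P_k\rho]\,\rho_k$ with countably many positive operators $P_k$ on $\mathcal H_A$ satisfying $\sum_k P_k\le I$, and states $\rho_k$ on $\mathcal H_{A'}$. Its success probability is $\mathrm{Tr}[\mathcal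 C(\sigma_A)]$, and its score is $$S(\mathcal C)=\frac{\mathrm{Tr}\big[O\,(\mathcal C\otimes\mathcal I_R)(\sigma_{AR})\big]}{\mathrm{Tr}[\mathcal C(\sigma_A)]}.$$ For $p\in(0,1]$, the benchmark at success probability $p$ is the supremum of $S(\mathcal C)$ over all measure-and-prepare devices with success probability $p$. The test is called fully black box if its benchmark is the same for all $p\in(0,1]$. Assume that $\Omega$ has positive partial transpose, $\Omega^{T_A}\ge 0$. For a state $\tau$ on $\mathcal H_A$ such that $I_{A'}\otimes\tau$ is invertible on the support of $\Omega$ (i.e. the support of $\Omega$ is contained in the support of $I_{A'}\otimes\tau$), let $$f(\tau)=\Lambda^{\otimes}\big[(I_{A'}\otimes\tau^{-1/2})\,\Omega\,(I_{A'}\otimes\tau^{-1/2})\big],$$ with values in the extended real line, where $\tau^{-1/2}$ is the inverse of $\tau^{1/2}$ on the support of $\tau$ (and zero on the kernel of $\tau$), and $\Lambda^{\otimes}(X)=\sup\langle\alpha'\otimes\alpha|X|\alpha'\otimes\alpha\rangle$ over unit vectors $\alpha'\in\mathcal H_{A'}$ and $\alpha\in\mathcal H_A$ (with $\alpha$ in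 the domain of $\tau^{-1/2}$). Then the test is fully black box if and only if $\sigma_A$ minimizes $f$ over all such states $\tau$. Moreover, if $\Omega\ne 0$, the function $f$ has exactly one minimizer $\tau_{\min}$, so that the test is fully black box if and only if $\sigma_A=\tau_{\min}$. -/

import Mathlib

open scoped InnerProductSpace ComplexOrder TensorProduct

set_option linter.unusedSectionVars false

noncomputable section

namespace QBench

/-! ### Composite systems, slices and traces -/

/-- The Hilbert space of a composite system: the completed Hilbert tensor product. -/
abbrev HTensor (E F : Type*) [NormedAddCommGroup E] [InnerProductSpace ℂ E]
    [NormedAddCommGroup F] [InnerProductSpace ℂ F] : Type _ :=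
  UniformSpace.Completion (E ⊗[ℂ] F)

section Operators

variable {E F G K : Type*}
  [NormedAddCommGroup E] [InnerProductSpace ℂ E] [CompleteSpace E]
  [NormedAddCommGroup F] [InnerProductSpace ℂ F] [CompleteSpace F]
  [NormedAddCommGroup G] [InnerProductSpace ℂ G] [CompleteSpace G]
  [NormedAddCommGroup K] [InnerProductSpace ℂ K] [CompleteSpace K]

/-- The product vector `x ⊗ y` in the Hilbert tensor product. -/
def pureTensor (x : E) (y : F) : HTensor E F := ((x ⊗ₜ[ℂ] y : E ⊗[ℂ] F) : HTensor E F)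

/-- The map `|x⟩ ⊗ I : F → E ⊗ F`, `y ↦ x ⊗ y`. -/
def ketFst (x : E) : F →L[ℂ] HTensor E F :=
  (UniformSpace.Completion.toComplL : E ⊗[ℂ] F →L[ℂ] HTensor E F) ∘L TensorProduct.mkL ℂ E F x

/-- The map `I ⊗ |y⟩ : E → E ⊗ F`, `x ↦ x ⊗ y`. -/
def ketSnd (y : F) : E →L[ℂ] HTensor E F :=
  (UniformSpace.Completion.toComplL : E ⊗[ℂ] F →L[ℂ] HTensor E F) ∘L
    (TensorProduct.mkL ℂ E F).flip y

/-- The operator `S ⊗ T` on the Hilbert tensor product. -/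
def tensorMap (S : E →L[ℂ] G) (T : F →L[ℂ] K) : HTensor E F →L[ℂ] HTensor G K :=
  ((UniformSpace.Completion.toComplL : G ⊗[ℂ] K →L[ℂ] HTensor G K) ∘L
    TensorProduct.mapL S T).extend
      (UniformSpace.Completion.toComplL : E ⊗[ℂ] F →L[ℂ] HTensor E F)

theorem ketFst_apply (x : E) (y : F) : ketFst x y = pureTensor x y := rfl

theorem ketSnd_apply (x : E) (y : F) : ketSnd y x = pureTensor x y := rfl

theorem inner_pureTensor (x x' : E) (y y' : F) :
    ⟪pureTensor x y, pureTensor x' y'⟫_ℂ = ⟪x, x'⟫_ℂ * ⟪y, y'⟫_ℂ := by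
  simp [pureTensor]

theorem tensorMap_pureTensor (S : E →L[ℂ] G) (T : F →L[ℂ] K) (x : E) (y : F) :
    tensorMap S T (pureTensor x y) = pureTensor (S x) (T y) := by
  have h := ContinuousLinearMap.extend_eq
    (f := (UniformSpace.Completion.toComplL : G ⊗[ℂ] K →L[ℂ] HTensor G K) ∘L
      TensorProduct.mapL S T)
    (e := (UniformSpace.Completion.toComplL : E ⊗[ℂ] F →L[ℂ] HTensor E F))
    (by simpa using UniformSpace.Completion.denseRange_coe)
    (by simpa using UniformSpace.Completion.isUniformInducing_coe _) (x ⊗ₜ[ℂ] y)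
  simpa [tensorMap, pureTensor] using h

/-- Index set of a fixed orthonormal (Hilbert) basis of `E`. -/
def basisIndex (E : Type*) [NormedAddCommGroup E] [InnerProductSpace ℂ E] [CompleteSpace E] :
    Set E :=
  (exists_hilbertBasis ℂ E).choose

/-- A fixed orthonormal (Hilbert) basis of `E`. -/
def fixedBasis (E : Type*) [NormedAddCommGroup E] [InnerProductSpace ℂ E] [CompleteSpace E] :
    HilbertBasis (basisIndex E) ℂ E :=
  (exists_hilbertBasis ℂ E).choose_spec.choose

/-- The trace `∑ᵢ ⟨eᵢ, T eᵢ⟩`; it is only applied to trace-class operators, for which the sum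
converges absolutely and does not depend on the basis. -/
def tr (T : E →L[ℂ] E) : ℂ :=
  ∑' i, ⟪fixedBasis E i, T (fixedBasis E i)⟫_ℂ

/-- A quantum state: a positive operator of trace one. (If the trace series of a positive operator
diverged, `tr` would be `0`, so `tr T = 1` includes the trace-class condition.) -/
def IsState (ρ : E →L[ℂ] E) : Prop := ρ.IsPositive ∧ tr ρ = 1

/-- The partial trace over the first tensor factor. -/
def traceFst (T : HTensor E F →L[ℂ] HTensor E F) : F →L[ℂ] F :=
  ∑' i, (ketFst (fixedBasis E i)).adjoint ∘L T ∘L ketFst (fixedBasis E i)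

/-- The partial trace over the second tensor factor. -/
def traceSnd (T : HTensor E F →L[ℂ] HTensor E F) : E →L[ℂ] E :=
  ∑' i, (ketSnd (fixedBasis F i)).adjoint ∘L T ∘L ketSnd (fixedBasis F i)

/-- The block `⟨x| T |x'⟩`, an operator on the second factor. -/
def block (T : HTensor E F →L[ℂ] HTensor E F) (x x' : E) : F →L[ℂ] F :=
  (ketFst x).adjoint ∘L T ∘L ketFst x'

/-- The support of an operator, i.e. the orthogonal complement of its kernel. -/
def support (T : E →L[ℂ] E) : Submodule ℂ E := (LinearMap.ker (T : E →ₗ[ℂ] E))ᗮ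

/-- The matrix of the partial transpose on the second factor with respect to the fixed bases:
`⟨i a| T^{T₂} |j b⟩ = ⟨i b| T |j a⟩`. -/
def partialTranspose (T : HTensor E F →L[ℂ] HTensor E F) :
    Matrix (basisIndex E × basisIndex F) (basisIndex E × basisIndex F) ℂ :=
  fun p q => ⟪pureTensor (fixedBasis E p.1) (fixedBasis F q.2),
    T (pureTensor (fixedBasis E q.1) (fixedBasis F p.2))⟫_ℂ

/-- `T` has positive partial transpose. -/
def IsPPT (T : HTensor E F →L[ℂ] HTensor E F) : Prop := (partialTranspose T).PosSemidef

/-- The graph of `τ^{-1/2}`, the (in general unbounded) Moore-Penrose inverse of `τ^{1/2}`: the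
pairs `(x, y)` such that `y` is orthogonal to the kernel of `τ^{1/2}` and `x - τ^{1/2} y` lies in
that kernel, which is the orthogonal complement of the range. -/
def invSqrtGraph (τ : E →L[ℂ] E) : Submodule ℂ (E × E) where
  carrier := {p | p.2 ∈ support (CFC.sqrt τ) ∧ CFC.sqrt τ (p.1 - CFC.sqrt τ p.2) = 0}
  zero_mem' := by simp
  add_mem' := by
    rintro p q ⟨hp, hp'⟩ ⟨hq, hq'⟩
    refine ⟨Submodule.add_mem _ hp hq, ?_⟩
    rw [Prod.fst_add, Prod.snd_add, map_add, add_sub_add_comm, map_add, hp', hq', add_zero]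
  smul_mem' := by
    rintro c p ⟨hp, hp'⟩
    refine ⟨Submodule.smul_mem _ c hp, ?_⟩
    rw [Prod.smul_fst, Prod.smul_snd, map_smul, ← smul_sub, map_smul, hp', smul_zero]

/-- The operator `τ^{-1/2}` (inverse on the support of `τ`, zero on the kernel of `τ`). -/
def invSqrt (τ : E →L[ℂ] E) : E →ₗ.[ℂ] E := (invSqrtGraph τ).toLinearPMap

/-- `invSqrtGraph τ` is the graph of an operator. -/
theorem invSqrt_graph (τ : E →L[ℂ] E) : (invSqrt τ).graph = invSqrtGraph τ := by
  refine Submodule.toLinearPMap_graph_eq _ ?_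
  rintro ⟨x, y⟩ ⟨hy, hxy⟩ hx
  simp only at hx hy hxy ⊢
  subst hx
  have hsa : (CFC.sqrt τ).adjoint = CFC.sqrt τ :=
    (IsSelfAdjoint.of_nonneg (CFC.sqrt_nonneg τ)).star_eq
  have h0 : CFC.sqrt τ (CFC.sqrt τ y) = 0 := by simpa using hxy
  have h1 : CFC.sqrt τ y = 0 := by
    have h2 : ⟪CFC.sqrt τ y, CFC.sqrt τ y⟫_ℂ = 0 := by
      rw [← ContinuousLinearMap.adjoint_inner_right, hsa, h0, inner_zero_right]
    exact inner_self_eq_zero.mp h2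
  exact inner_self_eq_zero.mp (hy y h1)

/-- The product numerical range `Λ^⊗` of `(I ⊗ X)† Ω (I ⊗ X)` for a possibly unbounded operator
`X` on the second factor: the supremum over unit vectors `α'`, and `α` in the domain of `X`, of
`⟨α' ⊗ X α| Ω |α' ⊗ X α⟩`. -/
def prodNumRange (Ω : HTensor E F →L[ℂ] HTensor E F) (X : F →ₗ.[ℂ] F) : EReal :=
  ⨆ (α' : E) (α : X.domain) (_ : ‖α'‖ = 1) (_ : ‖(α : F)‖ = 1),
    ((Complex.re ⟪pureTensor α' (X α), Ω (pureTensor α' (X α))⟫_ℂ : ℝ) : EReal)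

/-- The function `f(τ) = Λ^⊗[(I ⊗ τ^{-1/2}) Ω (I ⊗ τ^{-1/2})]`. -/
def objective (Ω : HTensor E F →L[ℂ] HTensor E F) (τ : F →L[ℂ] F) : EReal :=
  prodNumRange Ω (invSqrt τ)

/-- The states `τ` such that `I ⊗ τ` is invertible on the support of `Ω`. -/
def admissible (Ω : HTensor E F →L[ℂ] HTensor E F) : Set (F →L[ℂ] F) :=
  {τ | IsState τ ∧ support Ω ≤ support (tensorMap (1 : E →L[ℂ] E) τ)}

/-- `τ` minimizes `f` over the admissible states. -/
def IsMinimizer (Ω : HTensor E F →L[ℂ] HTensor E F) (τ : F →L[ℂ] F) : Prop :=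
  τ ∈ admissible Ω ∧ ∀ τ' ∈ admissible Ω, objective Ω τ ≤ objective Ω τ'

end Operators

/-! ### Devices, tests, scores and benchmarks -/

section Tests

variable (HA HA' HR : Type*)
  [NormedAddCommGroup HA] [InnerProductSpace ℂ HA] [CompleteSpace HA]
  [NormedAddCommGroup HA'] [InnerProductSpace ℂ HA'] [CompleteSpace HA']
  [NormedAddCommGroup HR] [InnerProductSpace ℂ HR] [CompleteSpace HR]

/-- A probabilistic measure-and-prepare device `𝒞(ρ) = ∑ₖ Tr[Pₖ ρ] ρₖ`: it measures positive
operators `Pₖ` with `∑ₖ Pₖ ≤ I` and prepares the state `ρₖ` for the outcome `k`; the remaining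
operator `I - ∑ₖ Pₖ` corresponds to failure. -/
structure MeasurePrepare where
  effect : ℕ → (HA →L[ℂ] HA)
  prep : ℕ → (HA' →L[ℂ] HA')
  effect_pos : ∀ k, (effect k).IsPositive
  effect_sum_le : ∀ s : Finset ℕ, ∑ k ∈ s, effect k ≤ 1
  prep_state : ∀ k, IsState (prep k)

/-- A test: a joint input state `σ_{AR}` and a bounded observable `O` on `A'R`. -/
structure Test where
  state : HTensor HA HR →L[ℂ] HTensor HA HR
  isState_state : IsState state
  obs : HTensor HA' HR →L[ℂ] HTensor HA' HR
  isSelfAdjoint_obs : IsSelfAdjoint obs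

variable {HA HA' HR}

/-- The action `𝒞(ρ) = ∑ₖ Tr[Pₖ ρ] ρₖ` of the device on system `A`. -/
def MeasurePrepare.apply (C : MeasurePrepare HA HA') (ρ : HA →L[ℂ] HA) : HA' →L[ℂ] HA' :=
  ∑' k, tr (C.effect k * ρ) • C.prep k

/-- The action `(𝒞 ⊗ ℐ_R)(σ) = ∑ₖ ρₖ ⊗ Tr_A[(Pₖ ⊗ I_R) σ]` of the device on the first part of a
joint state. -/
def MeasurePrepare.applyFst (C : MeasurePrepare HA HA') (σ : HTensor HA HR →L[ℂ] HTensor HA HR) :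
    HTensor HA' HR →L[ℂ] HTensor HA' HR :=
  ∑' k, tensorMap (C.prep k) (traceFst (tensorMap (C.effect k) (1 : HR →L[ℂ] HR) * σ))

namespace Test

variable (T : Test HA HA' HR)

/-- The marginal input state `σ_A = Tr_R[σ_{AR}]`. -/
def marginal : HA →L[ℂ] HA := traceSnd T.state

/-- `Ω` is the performance operator `Tr_R[(O_{A'R} ⊗ I_A)(I_{A'} ⊗ σ_{AR})]` of the test. It is the
bounded operator on `A'A` with the matrix elements
`⟨x ⊗ a| Ω |y ⊗ b⟩ = Tr_R[⟨x|O|y⟩ ⟨a|σ|b⟩]`, which determine it uniquely. -/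
def IsPerformanceOperator (Ω : HTensor HA' HA →L[ℂ] HTensor HA' HA) : Prop :=
  ∀ (x y : HA') (a b : HA),
    ⟪pureTensor x a, Ω (pureTensor y b)⟫_ℂ = tr (block T.obs x y * block T.state a b)

/-- The success probability `Tr[𝒞(σ_A)]`. -/
def succProb (C : MeasurePrepare HA HA') : ℝ := (tr (C.apply T.marginal)).re

/-- The score `Tr[O (𝒞 ⊗ ℐ_R)(σ_{AR})] / Tr[𝒞(σ_A)]`. -/
def score (C : MeasurePrepare HA HA') : ℝ :=
  (tr (T.obs * C.applyFst T.state)).re / T.succProb C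

/-- The benchmark at success probability `p`: the supremum of the scores of the measure-and-prepare
devices that succeed with probability `p`. -/
def benchmark (p : ℝ) : EReal :=
  ⨆ (C : MeasurePrepare HA HA') (_ : T.succProb C = p), (T.score C : EReal)

/-- The test is fully black box: its benchmark is the same at all success probabilities. -/
def FullyBlackBox : Prop :=
  ∀ p ∈ Set.Ioc (0 : ℝ) 1, ∀ q ∈ Set.Ioc (0 : ℝ) 1, T.benchmark p = T.benchmark q

end Test

end Tests

end QBench

end

/-! The theorem is a duality statement. Positive partial transpose is used only to make `⟨x ⊗ y|Ω|x
⊗ y⟩` nonnegative on product vectors.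

Write each effect as `Q²` and each prepared state as `R²`. The numerator of the score becomes a sum
of expectations of `Ω` at the vectors `R eᵢ ⊗ Q eⱼ` (`Test.tr_obs_applyFst`), and the success
probability becomes the sum of the expectations of `σ_A` at the same `Q eⱼ` (`Test.succProb_eq`).
For admissible `τ` and real `c ≥ 0`, `f(τ) ≤ c` means that `Ω ≤ c (I ⊗ τ)` on product vectors
(`Dominated`).

Write `b(p)` for the benchmark. Domination by `σ_A` gives `b(p) ≤ f(σ_A)` for every `p`, while
domination by any admissible `τ` gives `b(1) ≤ f(τ)`. Rank-one devices of suitable success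
probability show that `f(σ_A)` is at most any common upper bound of the `b(p)`. Conversely, a finite
subnormalized family of rank-one effects can be completed to a measurement and scaled to succeed
with probability exactly `p`, so its total gain is at most `b(p)`. A Hahn–Banach argument
(`exists_dominating_operator`) turns this into an operator of trace at most `b(p)` dominating `Ω`;
normalized, it is an admissible state with `f ≤ b(p)`.

Hence, for nonzero `Ω`, `b(1) = min f ≤ b(p) ≤ f(σ_A)`, and `f(σ_A)` is the supremum of the `b(p)`.
The benchmark is constant exactly when `f(σ_A) = min f`. Existence of a minimizer is the case `p =
1` of the duality. Uniqueness (`eq_of_dominated`) holds because two distinct minimizers can be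
combined into a dominating operator of strictly smaller trace. -/

namespace QBench

/-! ### Hilbert–Schmidt operators and traces -/

section HilbertSchmidt

open scoped ENNReal

variable {E F K : Type*}
  [NormedAddCommGroup E] [InnerProductSpace ℂ E] [CompleteSpace E]
  [NormedAddCommGroup F] [InnerProductSpace ℂ F] [CompleteSpace F]
  [NormedAddCommGroup K] [InnerProductSpace ℂ K] [CompleteSpace K]

theorem enorm_sq_eq_ofReal {X : Type*} [SeminormedAddCommGroup X] (x : X) :
    ‖x‖ₑ ^ 2 = ENNReal.ofReal (‖x‖ ^ 2) := by
  rw [← ofReal_norm, ENNReal.ofReal_pow (norm_nonneg _)]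

theorem enorm_inner_le (x y : E) : ‖⟪x, y⟫_ℂ‖ₑ ≤ ‖x‖ₑ * ‖y‖ₑ := by
  rw [← ofReal_norm, ← ofReal_norm, ← ofReal_norm, ← ENNReal.ofReal_mul (norm_nonneg _)]
  exact ENNReal.ofReal_le_ofReal (norm_inner_le_norm x y)

theorem re_inner_nonneg {T : E →L[ℂ] E} (hT : T.IsPositive) (x : E) : 0 ≤ (⟪x, T x⟫_ℂ).re :=
  hT.re_inner_nonneg_right x

theorem parseval {ι : Type*} (b : HilbertBasis ι ℂ E) (x : E) :
    ‖x‖ₑ ^ 2 = ∑' i, ‖⟪b i, x⟫_ℂ‖ₑ ^ 2 := by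
  have h := (b.hasSum_inner_mul_inner x x).mapL Complex.reCLM
  have h' : HasSum (fun i => ‖⟪b i, x⟫_ℂ‖ ^ 2) (‖x‖ ^ 2) := by
    convert h using 1
    · ext i
      rw [← inner_conj_symm x (b i), Complex.conj_mul']
      simp [← Complex.ofReal_pow]
    · rw [inner_self_eq_norm_sq_to_K]
      simp [← Complex.ofReal_pow]
  simp_rw [enorm_sq_eq_ofReal]
  rw [← h'.tsum_eq, ENNReal.ofReal_tsum_of_nonneg (fun _ => by positivity) h'.summable]

/-- Both sides are the sum of the squared moduli of all matrix elements of `A`, taken in the two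
possible orders. This makes the Hilbert–Schmidt norm basis independent. -/
theorem tsum_enorm_sq_adjoint {ι κ : Type*} (b : HilbertBasis ι ℂ E) (c : HilbertBasis κ ℂ F)
    (A : E →L[ℂ] F) : ∑' i, ‖A (b i)‖ₑ ^ 2 = ∑' j, ‖A.adjoint (c j)‖ₑ ^ 2 := by
  simp_rw [parseval c (A _), parseval b (A.adjoint _)]
  rw [ENNReal.tsum_comm]
  congr! 5 with j i
  rw [ContinuousLinearMap.adjoint_inner_right, ← enorm_norm, norm_inner_symm, enorm_norm]

/-- The squared Hilbert–Schmidt norm. -/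
noncomputable def hs (A : E →L[ℂ] F) : ℝ≥0∞ := ∑' i, ‖A (fixedBasis E i)‖ₑ ^ 2

theorem hs_eq_tsum {ι : Type*} (b : HilbertBasis ι ℂ E) (A : E →L[ℂ] F) :
    hs A = ∑' i, ‖A (b i)‖ₑ ^ 2 := by
  rw [hs, tsum_enorm_sq_adjoint _ (fixedBasis F), ← tsum_enorm_sq_adjoint b]

theorem hs_adjoint (A : E →L[ℂ] F) : hs A.adjoint = hs A := by
  rw [hs, hs, tsum_enorm_sq_adjoint _ (fixedBasis F)]

theorem hs_comp_le (W : F →L[ℂ] K) (A : E →L[ℂ] F) : hs (W ∘L A) ≤ ‖W‖ₑ ^ 2 * hs A := by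
  rw [hs, hs, ← ENNReal.tsum_mul_left]
  refine ENNReal.tsum_le_tsum fun i => ?_
  rw [← mul_pow]
  gcongr
  exact W.le_opENorm _

theorem hs_comp_le' (A : F →L[ℂ] K) (W : E →L[ℂ] F) : hs (A ∘L W) ≤ ‖W‖ₑ ^ 2 * hs A := by
  rw [← hs_adjoint, ContinuousLinearMap.adjoint_comp, ← hs_adjoint A]
  refine (hs_comp_le _ _).trans_eq ?_
  rw [← enorm_norm, LinearIsometryEquiv.norm_map, enorm_norm]

/-- Expanding `A x` by Parseval, each coefficient is `⟪A† cᵢ, x⟫`, and Cauchy–Schwarz bounds it by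
`‖A† cᵢ‖ ‖x‖`. -/
theorem enorm_sq_le_hs (A : E →L[ℂ] F) : ‖A‖ₑ ^ 2 ≤ hs A := by
  by_cases h : hs A = ∞
  · simp [h]
  have : ‖A‖ ≤ √(hs A).toReal := by
    refine A.opNorm_le_bound (by positivity) fun x => ?_
    refine le_of_sq_le_sq ?_ (by positivity)
    rw [mul_pow, Real.sq_sqrt (by positivity)]
    have h1 : ‖A x‖ₑ ^ 2 ≤ hs A * ‖x‖ₑ ^ 2 := by
      rw [parseval (fixedBasis F), ← hs_adjoint, hs, ← ENNReal.tsum_mul_right]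
      refine ENNReal.tsum_le_tsum fun i => ?_
      rw [← mul_pow, ← ContinuousLinearMap.adjoint_inner_left]
      gcongr
      exact enorm_inner_le _ _
    have h2 := ENNReal.toReal_mono (ENNReal.mul_ne_top h (by simp)) h1
    simpa using h2
  rw [← ENNReal.ofReal_toReal h, enorm_sq_eq_ofReal]
  refine ENNReal.ofReal_le_ofReal ?_
  calc ‖A‖ ^ 2 ≤ √(hs A).toReal ^ 2 := by gcongr
    _ = _ := Real.sq_sqrt (by positivity)

theorem enorm_inner_le_sq_add_sq (x y : E) : ‖⟪x, y⟫_ℂ‖ₑ ≤ ‖x‖ₑ ^ 2 + ‖y‖ₑ ^ 2 := by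
  rw [enorm_sq_eq_ofReal, enorm_sq_eq_ofReal, ← ENNReal.ofReal_add (by positivity) (by positivity),
    ← ofReal_norm]
  refine ENNReal.ofReal_le_ofReal ((norm_inner_le_norm x y).trans ?_)
  nlinarith [sq_nonneg (‖x‖ - ‖y‖), sq_nonneg ‖x‖, sq_nonneg ‖y‖]

theorem summable_of_tsum_enorm_ne_top {X ι : Type*} [NormedAddCommGroup X] [CompleteSpace X]
    {f : ι → X} (h : ∑' i, ‖f i‖ₑ ≠ ∞) :
    Summable f := by
  refine Summable.of_norm ?_
  have := ENNReal.summable_toReal h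
  simpa using this

theorem tsum_enorm_inner_le {ι : Type*} (b : HilbertBasis ι ℂ E) (A B : E →L[ℂ] F) :
    ∑' i, ‖⟪A (b i), B (b i)⟫_ℂ‖ₑ ≤ hs A + hs B := by
  rw [hs_eq_tsum b A, hs_eq_tsum b B, ← ENNReal.tsum_add]
  exact ENNReal.tsum_le_tsum fun i => enorm_inner_le_sq_add_sq _ _

theorem summable_inner_hs {ι : Type*} (b : HilbertBasis ι ℂ E) {A B : E →L[ℂ] F}
    (hA : hs A ≠ ∞) (hB : hs B ≠ ∞) : Summable fun i => ⟪A (b i), B (b i)⟫_ℂ :=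
  summable_of_tsum_enorm_ne_top
    ((tsum_enorm_inner_le b A B).trans_lt (ENNReal.add_lt_top.2 ⟨hA.lt_top, hB.lt_top⟩)).ne

/-- The Hilbert–Schmidt inner product can be computed from the adjoints. -/
theorem tsum_inner_adjoint {ι κ : Type*} (b : HilbertBasis ι ℂ E) (c : HilbertBasis κ ℂ F)
    {A B : E →L[ℂ] F} (hA : hs A ≠ ∞) (hB : hs B ≠ ∞) :
    ∑' i, ⟪A (b i), B (b i)⟫_ℂ = ∑' j, ⟪B.adjoint (c j), A.adjoint (c j)⟫_ℂ := by
  have key : ∀ i j, ⟪A (b i), c j⟫_ℂ * ⟪c j, B (b i)⟫_ℂ =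
      ⟪B.adjoint (c j), b i⟫_ℂ * ⟪b i, A.adjoint (c j)⟫_ℂ := fun i j => by
    rw [ContinuousLinearMap.adjoint_inner_left, ContinuousLinearMap.adjoint_inner_right, mul_comm]
  -- Absolute summability of the double series, from `|ab| ≤ |a|² + |b|²`, justifies exchanging the
  -- sums.
  have hsum : Summable (Function.uncurry fun (i : ι) (j : κ) =>
      ⟪A (b i), c j⟫_ℂ * ⟪c j, B (b i)⟫_ℂ) := by
    refine summable_of_tsum_enorm_ne_top (ne_top_of_le_ne_top (ENNReal.add_ne_top.2 ⟨hA, hB⟩) ?_)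
    rw [ENNReal.tsum_prod', hs_eq_tsum b A, hs_eq_tsum b B, ← ENNReal.tsum_add]
    refine ENNReal.tsum_le_tsum fun i => ?_
    rw [parseval c (A _), parseval c (B _), ← ENNReal.tsum_add]
    refine ENNReal.tsum_le_tsum fun j => ?_
    simp only [Function.uncurry_apply_pair]
    have := enorm_inner_le_sq_add_sq (⟪c j, A (b i)⟫_ℂ) (⟪c j, B (b i)⟫_ℂ)
    refine le_trans (le_of_eq ?_) this
    simp [mul_comm]
  calc _ = ∑' i, ∑' j, ⟪A (b i), c j⟫_ℂ * ⟪c j, B (b i)⟫_ℂ := by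
        simp_rw [c.tsum_inner_mul_inner]
    _ = ∑' j, ∑' i, ⟪A (b i), c j⟫_ℂ * ⟪c j, B (b i)⟫_ℂ := hsum.tsum_comm.symm
    _ = _ := by simp_rw [key, b.tsum_inner_mul_inner]

theorem exists_sqrt {T : E →L[ℂ] E} (hT : T.IsPositive) :
    ∃ R : E →L[ℂ] E, R.adjoint = R ∧ R ∘L R = T := by
  refine ⟨CFC.sqrt T, (IsSelfAdjoint.of_nonneg (CFC.sqrt_nonneg T)).star_eq, ?_⟩
  exact CFC.sqrt_mul_sqrt_self T ((ContinuousLinearMap.nonneg_iff_isPositive T).2 hT)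

theorem IsPositive.inner_eq_ofReal {T : E →L[ℂ] E} (hT : T.IsPositive) (x : E) :
    ⟪x, T x⟫_ℂ = ((⟪x, T x⟫_ℂ).re : ℂ) := by
  have := hT.inner_nonneg_right x
  rw [Complex.nonneg_iff] at this
  exact Complex.ext rfl (by simp [← this.2])

/-- The nonnegative part of the quadratic form of an operator. -/
noncomputable def qf (T : E →L[ℂ] E) (x : E) : ℝ≥0∞ := ENNReal.ofReal (⟪x, T x⟫_ℂ).re

/-- The trace of a positive operator, as an extended nonnegative number. -/
noncomputable def ptr (T : E →L[ℂ] E) : ℝ≥0∞ := ∑' i, qf T (fixedBasis E i)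

theorem qf_adjoint_comp (A : E →L[ℂ] F) (x : E) : qf (A.adjoint ∘L A) x = ‖A x‖ₑ ^ 2 := by
  rw [qf, ContinuousLinearMap.comp_apply, ContinuousLinearMap.adjoint_inner_right,
    inner_self_eq_norm_sq_to_K, enorm_sq_eq_ofReal]
  simp [← Complex.ofReal_pow]

theorem qf_sqrt {R : E →L[ℂ] E} (hR : R.adjoint = R) (x : E) : qf (R ∘L R) x = ‖R x‖ₑ ^ 2 := by
  conv_lhs => enter [1, 1]; rw [← hR]
  exact qf_adjoint_comp R x

theorem qf_conj (A : E →L[ℂ] F) (T : F →L[ℂ] F) (x : E) :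
    qf (A.adjoint ∘L T ∘L A) x = qf T (A x) := by
  simp [qf, ContinuousLinearMap.adjoint_inner_right]

theorem qf_smul_op {c : ℝ} (hc : 0 ≤ c) (T : E →L[ℂ] E) (x : E) :
    qf ((c : ℂ) • T) x = ENNReal.ofReal c * qf T x := by
  rw [qf, qf, ← ENNReal.ofReal_mul hc]
  simp

theorem qf_ne_top (T : E →L[ℂ] E) (x : E) : qf T x ≠ ∞ := ENNReal.ofReal_ne_top

theorem ptr_adjoint_comp (A : E →L[ℂ] F) : ptr (A.adjoint ∘L A) = hs A := by
  simp_rw [ptr, qf_adjoint_comp, hs]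

theorem ptr_sqrt {R : E →L[ℂ] E} (hR : R.adjoint = R) : ptr (R ∘L R) = hs R := by
  simp_rw [ptr, qf_sqrt hR, hs]

theorem ptr_eq_tsum {ι : Type*} (b : HilbertBasis ι ℂ E) {T : E →L[ℂ] E} (hT : T.IsPositive) :
    ptr T = ∑' i, qf T (b i) := by
  obtain ⟨R, hR, rfl⟩ := exists_sqrt hT
  simp_rw [ptr_sqrt hR, qf_sqrt hR, hs_eq_tsum b]

theorem ptr_smul {c : ℝ} (hc : 0 ≤ c) (T : E →L[ℂ] E) :
    ptr ((c : ℂ) • T) = ENNReal.ofReal c * ptr T := by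
  simp_rw [ptr, qf_smul_op hc, ENNReal.tsum_mul_left]

theorem enorm_le_ptr {T : E →L[ℂ] E} (hT : T.IsPositive) : ‖T‖ₑ ≤ ptr T := by
  obtain ⟨R, hR, rfl⟩ := exists_sqrt hT
  rw [ptr_sqrt hR]
  refine le_trans ?_ (enorm_sq_le_hs R)
  rw [sq]
  exact ENNReal.ofReal_le_ofReal (R.opNorm_comp_le R) |>.trans_eq (by
    rw [ENNReal.ofReal_mul (norm_nonneg _), ofReal_norm]) |> (by simpa using ·)

/-- Cyclicity of the trace in the form `Tr[W A† A] = Tr[A W A†]`. -/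
theorem tsum_mul_adjoint_comp {ι κ : Type*} (b : HilbertBasis ι ℂ E) (c : HilbertBasis κ ℂ F)
    {A : E →L[ℂ] F} (hA : hs A ≠ ∞) (W : E →L[ℂ] E) :
    (Summable fun i => ⟪b i, W (A.adjoint (A (b i)))⟫_ℂ) ∧
    (Summable fun j => ⟪A.adjoint (c j), W (A.adjoint (c j))⟫_ℂ) ∧
    ∑' i, ⟪b i, W (A.adjoint (A (b i)))⟫_ℂ = ∑' j, ⟪A.adjoint (c j), W (A.adjoint (c j))⟫_ℂ := by
  have h1 : hs (A ∘L W.adjoint) ≠ ∞ :=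
    ne_top_of_le_ne_top (ENNReal.mul_ne_top (by simp) hA) (hs_comp_le' A _)
  have e1 : ∀ i, ⟪b i, W (A.adjoint (A (b i)))⟫_ℂ = ⟪(A ∘L W.adjoint) (b i), A (b i)⟫_ℂ := fun i => by
    rw [ContinuousLinearMap.comp_apply, ← ContinuousLinearMap.adjoint_inner_right,
      ContinuousLinearMap.adjoint_inner_left]
  have e2 : ∀ j, ⟪A.adjoint (c j), W (A.adjoint (c j))⟫_ℂ =
      ⟪A.adjoint (c j), (A ∘L W.adjoint).adjoint (c j)⟫_ℂ := fun j => by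
    rw [ContinuousLinearMap.adjoint_comp, ContinuousLinearMap.adjoint_adjoint]; rfl
  simp_rw [e1, e2]
  refine ⟨summable_inner_hs b h1 hA, ?_, tsum_inner_adjoint b c h1 hA⟩
  exact summable_inner_hs c (by rwa [hs_adjoint]) (by rwa [hs_adjoint])

/-- With `T = R²`, cyclicity turns the sum over any basis into the same sum of `⟪R e, W R e⟫` over
the fixed basis, so `tr (W * T)` may be computed in any basis. -/
theorem tr_mul_eq {ι : Type*} (b : HilbertBasis ι ℂ E) {T : E →L[ℂ] E} (hT : T.IsPositive)
    (h : ptr T ≠ ∞) (W : E →L[ℂ] E) :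
    HasSum (fun i => ⟪b i, W (T (b i))⟫_ℂ) (tr (W * T)) := by
  obtain ⟨R, hR, rfl⟩ := exists_sqrt hT
  rw [ptr_sqrt hR] at h
  have h1 := tsum_mul_adjoint_comp b (fixedBasis E) h W
  have h2 := tsum_mul_adjoint_comp (fixedBasis E) (fixedBasis E) h W
  rw [hR] at h1 h2
  refine (h1.1.hasSum_iff.2 ?_)
  exact h1.2.2.trans h2.2.2.symm

theorem tr_mul_adjoint_comp {κ : Type*} (c : HilbertBasis κ ℂ F) {A : E →L[ℂ] F} (hA : hs A ≠ ∞)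
    (W : E →L[ℂ] E) :
    HasSum (fun j => ⟪A.adjoint (c j), W (A.adjoint (c j))⟫_ℂ) (tr (W * (A.adjoint ∘L A))) := by
  have h1 := tsum_mul_adjoint_comp (fixedBasis E) c hA W
  exact h1.2.1.hasSum_iff.2 h1.2.2.symm

theorem tr_mul_sqrt {κ : Type*} (c : HilbertBasis κ ℂ E) {R : E →L[ℂ] E} (hR : R.adjoint = R)
    (h : hs R ≠ ∞) (W : E →L[ℂ] E) :
    HasSum (fun j => ⟪R (c j), W (R (c j))⟫_ℂ) (tr (W * (R ∘L R))) := by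
  have := tr_mul_adjoint_comp c h W
  rwa [hR] at this

/-- The crude factor `‖W‖² + 1` comes from `|⟪a, b⟫| ≤ ‖a‖² + ‖b‖²` with `a = R W† e`, `b = R e`. It
is enough for summability and for the finiteness of `f(σ_A)`. -/
theorem tsum_enorm_inner_mul_le {ι : Type*} (b : HilbertBasis ι ℂ E) {T : E →L[ℂ] E}
    (hT : T.IsPositive) (W : E →L[ℂ] E) :
    ∑' i, ‖⟪b i, W (T (b i))⟫_ℂ‖ₑ ≤ (‖W‖ₑ ^ 2 + 1) * ptr T := by
  obtain ⟨R, hR, rfl⟩ := exists_sqrt hT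
  rw [ptr_sqrt hR, add_mul, one_mul]
  have e1 : ∀ i, ⟪b i, W (R (R (b i)))⟫_ℂ = ⟪(R ∘L W.adjoint) (b i), R (b i)⟫_ℂ := fun i => by
    rw [ContinuousLinearMap.comp_apply]
    conv_rhs => rw [← hR]
    rw [ContinuousLinearMap.adjoint_inner_left, ContinuousLinearMap.adjoint_inner_left, hR]
  simp_rw [ContinuousLinearMap.comp_apply, e1]
  refine (tsum_enorm_inner_le b _ _).trans ?_
  gcongr
  refine (hs_comp_le' _ _).trans_eq ?_
  rw [← enorm_norm, LinearIsometryEquiv.norm_map, enorm_norm]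

theorem enorm_tr_mul_le {T : E →L[ℂ] E} (hT : T.IsPositive) (W : E →L[ℂ] E) (h : ptr T ≠ ∞) :
    ‖tr (W * T)‖ₑ ≤ (‖W‖ₑ ^ 2 + 1) * ptr T := by
  refine le_trans ?_ (tsum_enorm_inner_mul_le (fixedBasis E) hT W)
  rw [← (tr_mul_eq (fixedBasis E) hT h W).tsum_eq]
  exact enorm_tsum_le_tsum_enorm 

theorem tr_eq_ptr {T : E →L[ℂ] E} (hT : T.IsPositive) (h : ptr T ≠ ∞) :
    tr T = ((ptr T).toReal : ℂ) := by
  have h1 := tr_mul_eq (fixedBasis E) hT h 1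
  rw [one_mul] at h1
  rw [← h1.tsum_eq, ptr, ENNReal.tsum_toReal_eq (fun i => qf_ne_top _ _), Complex.ofReal_tsum]
  refine tsum_congr fun i => ?_
  rw [one_apply_eq_self, qf, ENNReal.toReal_ofReal (re_inner_nonneg hT _)]
  exact IsPositive.inner_eq_ofReal hT _

/-- A non-summable `tsum` is `0`, so trace one forces convergence. Passing to `ptr` allows later
sums to be rearranged in `ℝ≥0∞` without summability conditions. -/
theorem isState_iff {ρ : E →L[ℂ] E} : IsState ρ ↔ ρ.IsPositive ∧ ptr ρ = 1 := by
  refine and_congr_right fun hρ => ⟨fun h => ?_, fun h => ?_⟩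
  · have hs : Summable fun i => ⟪fixedBasis E i, ρ (fixedBasis E i)⟫_ℂ := by
      by_contra hs
      rw [tr, tsum_eq_zero_of_not_summable hs] at h
      exact zero_ne_one h
    have hfin : ptr ρ ≠ ∞ := by
      have := (hs.mapL Complex.reCLM)
      rw [ptr]; simp_rw [qf]
      rw [← ENNReal.ofReal_tsum_of_nonneg (fun i => re_inner_nonneg hρ _) this]
      simp
    rw [tr_eq_ptr hρ hfin] at h
    rw [← ENNReal.ofReal_toReal hfin]
    have : (ptr ρ).toReal = 1 := by exact_mod_cast h
    simp [this]
  · rw [tr_eq_ptr hρ (by simp [h]), h]; simp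

/-- A series of positive operators whose traces are summable converges in norm, and traces against
bounded operators can be computed termwise. -/
theorem positive_series {ι : Type*} {T : ι → E →L[ℂ] E} (hT : ∀ k, (T k).IsPositive)
    (h : ∑' k, ptr (T k) ≠ ∞) :
    Summable T ∧ (∑' k, T k).IsPositive ∧ (∀ x, qf (∑' k, T k) x = ∑' k, qf (T k) x) ∧
    ptr (∑' k, T k) = ∑' k, ptr (T k) ∧
    ∀ W : E →L[ℂ] E, HasSum (fun k => tr (W * T k)) (tr (W * ∑' k, T k)) := by
  have hS : Summable T := summable_of_tsum_enorm_ne_top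
    (ne_top_of_le_ne_top h (ENNReal.tsum_le_tsum fun k => enorm_le_ptr (hT k)))
  have happ : ∀ x y, HasSum (fun k => ⟪x, T k y⟫_ℂ) ⟪x, (∑' k, T k) y⟫_ℂ := fun x y =>
    (hS.hasSum.mapL (ContinuousLinearMap.apply ℂ E y)).mapL (innerSL ℂ x)
  have hpos : (∑' k, T k).IsPositive := by
    rw [← ContinuousLinearMap.nonneg_iff_isPositive]
    exact tsum_nonneg fun k => (ContinuousLinearMap.nonneg_iff_isPositive _).2 (hT k)
  have hqf : ∀ x, qf (∑' k, T k) x = ∑' k, qf (T k) x := fun x => by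
    have := (happ x x).mapL Complex.reCLM
    simp_rw [qf]
    rw [← ENNReal.ofReal_tsum_of_nonneg (fun k => re_inner_nonneg (hT k) x) this.summable]
    exact congrArg _ this.tsum_eq.symm
  have hptr : ptr (∑' k, T k) = ∑' k, ptr (T k) := by
    simp_rw [ptr, hqf]
    rw [ENNReal.tsum_comm]
  refine ⟨hS, hpos, hqf, hptr, fun W => ?_⟩
  -- Fubini over the series index and the basis index; the crude trace bound supplies absolute
  -- summability.
  have hsum : Summable (Function.uncurry fun (k : ι) (i : basisIndex E) =>
      ⟪fixedBasis E i, W (T k (fixedBasis E i))⟫_ℂ) := by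
    refine summable_of_tsum_enorm_ne_top
      (ne_top_of_le_ne_top (ENNReal.mul_ne_top (a := ‖W‖ₑ ^ 2 + 1) (by simp) h) ?_)
    rw [ENNReal.tsum_prod', ← ENNReal.tsum_mul_left]
    exact ENNReal.tsum_le_tsum fun k => tsum_enorm_inner_mul_le _ (hT k) W
  have hfin : ∀ k, ptr (T k) ≠ ∞ := fun k => ENNReal.ne_top_of_tsum_ne_top h k
  have e1 : (fun k => tr (W * T k)) = fun k => ∑' i, ⟪fixedBasis E i, W (T k (fixedBasis E i))⟫_ℂ :=
    rfl
  rw [e1]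
  refine (hsum.prod.hasSum_iff).2 ?_
  refine hsum.tsum_comm.symm.trans ?_
  refine tsum_congr fun i => ?_
  have := (((hS.hasSum.mapL (ContinuousLinearMap.apply ℂ E (fixedBasis E i))).mapL W).mapL
    (innerSL ℂ (fixedBasis E i)))
  exact this.tsum_eq

end HilbertSchmidt

/-! ### Product bases, blocks and partial traces -/

section TensorOperators

open scoped ENNReal

variable {E F G K : Type*}
  [NormedAddCommGroup E] [InnerProductSpace ℂ E] [CompleteSpace E]
  [NormedAddCommGroup F] [InnerProductSpace ℂ F] [CompleteSpace F]
  [NormedAddCommGroup G] [InnerProductSpace ℂ G] [CompleteSpace G]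
  [NormedAddCommGroup K] [InnerProductSpace ℂ K] [CompleteSpace K]

theorem norm_pureTensor (x : E) (y : F) : ‖pureTensor x y‖ = ‖x‖ * ‖y‖ := by
  simp [pureTensor]

theorem span_pureTensor_dense :
    Dense (Submodule.span ℂ (Set.range fun p : E × F => pureTensor p.1 p.2) : Set (HTensor E F)) := by
  have h : Submodule.span ℂ (Set.range fun p : E × F => pureTensor p.1 p.2) =
      LinearMap.range ((UniformSpace.Completion.toComplL : E ⊗[ℂ] F →L[ℂ] HTensor E F) :
        E ⊗[ℂ] F →ₗ[ℂ] HTensor E F) := by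
    rw [LinearMap.range_eq_map, ← TensorProduct.span_tmul_eq_top, Submodule.map_span]
    congr 1
    ext z
    simp [pureTensor]
  rw [h]
  exact UniformSpace.Completion.denseRange_coe

theorem ext_inner_pureTensor {v w : HTensor E F}
    (h : ∀ x y, ⟪pureTensor x y, v⟫_ℂ = ⟪pureTensor x y, w⟫_ℂ) : v = w := by
  have h0 : v - w = 0 := Dense.eq_zero_of_mem_orthogonal span_pureTensor_dense <| by
    rw [Submodule.mem_orthogonal]
    refine fun u hu => Submodule.span_induction ?_ (by simp) ?_ ?_ hu
    · rintro _ ⟨p, rfl⟩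
      rw [inner_sub_right, h, sub_self]
    · intro a b _ _ ha hb
      rw [inner_add_left, ha, hb, add_zero]
    · intro c a _ ha
      rw [inner_smul_left, ha, mul_zero]
  exact sub_eq_zero.1 h0

theorem ext_pureTensor {S T : HTensor E F →L[ℂ] G}
    (h : ∀ x y, S (pureTensor x y) = T (pureTensor x y)) : S = T := by
  refine ContinuousLinearMap.ext_on span_pureTensor_dense ?_
  rintro _ ⟨p, rfl⟩
  exact h _ _

theorem eq_zero_of_inner_basis {ι : Type*} (b : HilbertBasis ι ℂ E) {x : E}
    (h : ∀ i, ⟪b i, x⟫_ℂ = 0) : x = 0 := by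
  have := parseval b x
  simpa [h] using this

theorem ketFst_adjoint_inner (x : E) (y : F) (v : HTensor E F) :
    ⟪y, (ketFst x).adjoint v⟫_ℂ = ⟪pureTensor x y, v⟫_ℂ := by
  rw [ContinuousLinearMap.adjoint_inner_right, ketFst_apply]

theorem ketSnd_adjoint_inner (x : E) (y : F) (v : HTensor E F) :
    ⟪x, (ketSnd y).adjoint v⟫_ℂ = ⟪pureTensor x y, v⟫_ℂ := by
  rw [ContinuousLinearMap.adjoint_inner_right, ketSnd_apply]

theorem eq_zero_of_ketFst_adjoint {ι : Type*} (b : HilbertBasis ι ℂ E) {v : HTensor E F}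
    (h : ∀ i, (ketFst (b i)).adjoint v = 0) : v = 0 := by
  refine ext_inner_pureTensor fun x y => ?_
  have h2 : (ketSnd y).adjoint v = 0 := eq_zero_of_inner_basis b fun i => by
    rw [ketSnd_adjoint_inner, ← ketFst_adjoint_inner, h, inner_zero_right]
  rw [← ketSnd_adjoint_inner, h2, inner_zero_right, inner_zero_right]

theorem exists_prodBasis {ι κ : Type*} (b : HilbertBasis ι ℂ E) (c : HilbertBasis κ ℂ F) :
    ∃ d : HilbertBasis (ι × κ) ℂ (HTensor E F), ∀ p, d p = pureTensor (b p.1) (c p.2) := by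
  classical
  have ho : Orthonormal ℂ fun p : ι × κ => pureTensor (b p.1) (c p.2) := by
    rw [orthonormal_iff_ite]
    rintro ⟨i, k⟩ ⟨j, l⟩
    rw [inner_pureTensor, orthonormal_iff_ite.1 b.orthonormal, orthonormal_iff_ite.1 c.orthonormal]
    by_cases h1 : i = j <;> by_cases h2 : k = l <;> simp [h1, h2]
  refine ⟨HilbertBasis.mkOfOrthogonalEqBot ho ?_, fun p => by rw [HilbertBasis.coe_mkOfOrthogonalEqBot]⟩
  rw [Submodule.eq_bot_iff]
  intro v hv
  have hv' : ∀ i k, ⟪pureTensor (b i) (c k), v⟫_ℂ = 0 := fun i k =>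
    (Submodule.mem_orthogonal _ _).1 hv _ (Submodule.subset_span ⟨(i, k), rfl⟩)
  refine eq_zero_of_ketFst_adjoint b fun i => eq_zero_of_inner_basis c fun k => ?_
  rw [ketFst_adjoint_inner, hv']

theorem inner_block (T : HTensor E F →L[ℂ] HTensor E F) (x x' : E) (y y' : F) :
    ⟪y, block T x x' y'⟫_ℂ = ⟪pureTensor x y, T (pureTensor x' y')⟫_ℂ := by
  simp [block, ContinuousLinearMap.adjoint_inner_right, ketFst_apply]

theorem adjoint_tensorMap (S : E →L[ℂ] G) (T : F →L[ℂ] K) :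
    (tensorMap S T).adjoint = tensorMap S.adjoint T.adjoint := by
  refine ext_pureTensor fun x y => ext_inner_pureTensor fun x' y' => ?_
  rw [ContinuousLinearMap.adjoint_inner_right, tensorMap_pureTensor, tensorMap_pureTensor,
    inner_pureTensor, inner_pureTensor, ContinuousLinearMap.adjoint_inner_right,
    ContinuousLinearMap.adjoint_inner_right]

theorem tensorMap_comp {E' F' : Type*} [NormedAddCommGroup E'] [InnerProductSpace ℂ E']
    [CompleteSpace E'] [NormedAddCommGroup F'] [InnerProductSpace ℂ F'] [CompleteSpace F']
    (S : E →L[ℂ] G) (T : F →L[ℂ] K) (S' : E' →L[ℂ] E) (T' : F' →L[ℂ] F) :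
    tensorMap (S ∘L S') (T ∘L T') = tensorMap S T ∘L tensorMap S' T' :=
  ext_pureTensor fun x y => by simp [tensorMap_pureTensor]

theorem hs_tensorMap (S : E →L[ℂ] G) (T : F →L[ℂ] K) : hs (tensorMap S T) = hs S * hs T := by
  obtain ⟨d, hd⟩ := exists_prodBasis (fixedBasis E) (fixedBasis F)
  rw [hs_eq_tsum d, ENNReal.tsum_prod', hs, hs, ← ENNReal.tsum_mul_right]
  refine tsum_congr fun i => ?_
  rw [← ENNReal.tsum_mul_left]
  refine tsum_congr fun j => ?_
  rw [hd, tensorMap_pureTensor, ← mul_pow, ← enorm_norm, norm_pureTensor, enorm_mul, enorm_norm,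
    enorm_norm]

theorem block_isPositive {T : HTensor E F →L[ℂ] HTensor E F} (hT : T.IsPositive) (x : E) :
    (block T x x).IsPositive :=
  hT.adjoint_conj (ketFst x)

/-- The partial trace of a positive trace-class operator. -/
theorem traceSnd_spec {T : HTensor E F →L[ℂ] HTensor E F} (hT : T.IsPositive) (h : ptr T ≠ ∞) :
    (traceSnd T).IsPositive ∧ ptr (traceSnd T) = ptr T ∧
      ∀ x, ptr (block T x x) = qf (traceSnd T) x := by
  obtain ⟨d, hd⟩ := exists_prodBasis (fixedBasis E) (fixedBasis F)
  have hpos : ∀ i, ((ketSnd (fixedBasis F i)).adjoint ∘L T ∘L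
      ketSnd (E := E) (fixedBasis F i)).IsPositive := fun i => hT.adjoint_conj _
  -- The traces of the slices regroup the trace of `T` in the product basis.
  have hsum : ∑' i, ptr ((ketSnd (fixedBasis F i)).adjoint ∘L T ∘L
      ketSnd (E := E) (fixedBasis F i)) = ptr T := by
    rw [ptr_eq_tsum d hT, ENNReal.tsum_prod', ENNReal.tsum_comm]
    simp_rw [ptr, qf_conj, hd, ketSnd_apply]
  obtain ⟨-, h1, h2, h3, -⟩ := positive_series hpos (by rwa [hsum])
  refine ⟨h1, h3.trans hsum, fun x => ?_⟩
  rw [traceSnd, h2]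
  simp_rw [ptr, block, qf_conj]
  rfl

theorem traceSnd_isState {T : HTensor E F →L[ℂ] HTensor E F} (hT : IsState T) :
    IsState (traceSnd T) := by
  rw [isState_iff] at hT ⊢
  obtain ⟨h1, h2, -⟩ := traceSnd_spec hT.1 (by simp [hT.2])
  exact ⟨h1, h2.trans hT.2⟩

/-- `Tr_A[(P ⊗ I) σ] = ∑ⱼ ⟨Q eⱼ|σ|Q eⱼ⟩` for `P = Q²`. -/
theorem traceFst_mul {σ : HTensor E F →L[ℂ] HTensor E F} (hσ : σ.IsPositive) (h : ptr σ ≠ ∞)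
    {Q : E →L[ℂ] E} (hQ : Q.adjoint = Q) :
    ∑' j, ptr (block σ (Q (fixedBasis E j)) (Q (fixedBasis E j))) ≠ ∞ ∧
    traceFst (tensorMap (Q ∘L Q) (1 : F →L[ℂ] F) * σ) =
      ∑' j, block σ (Q (fixedBasis E j)) (Q (fixedBasis E j)) := by
  obtain ⟨hm, hm1, hm2⟩ := traceSnd_spec hσ h
  -- The trace of the diagonal block at `A eⱼ` is the quadratic form of the marginal there. With the
  -- marginal equal to `R²`, the sum is the squared Hilbert–Schmidt norm of `R A`.
  have hfin : ∀ A : E →L[ℂ] E, ∑' j, ptr (block σ (A (fixedBasis E j)) (A (fixedBasis E j))) ≠ ∞ := by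
    intro A
    simp_rw [hm2]
    obtain ⟨R, hR, hRR⟩ := exists_sqrt hm
    rw [← hRR]
    simp_rw [qf_sqrt hR]
    refine ne_top_of_le_ne_top (ENNReal.mul_ne_top (by simp) ?_) (hs_comp_le' R A)
    rwa [← ptr_sqrt hR, hRR, hm1]
  refine ⟨hfin Q, ?_⟩
  obtain ⟨hS, -, -, -, -⟩ := positive_series (fun j => block_isPositive hσ _) (hfin Q)
  obtain ⟨R, hR, rfl⟩ := exists_sqrt hσ
  have hRfin : hs R ≠ ∞ := by rwa [← ptr_sqrt hR]
  -- Absorbing `Q² ⊗ I` into the bra `⟨x| ⊗ I` displays the slice as a product of two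
  -- Hilbert–Schmidt operators, which yields norm summability and allows cyclicity.
  have e : ∀ x : E, (ketFst x).adjoint ∘L (tensorMap (Q ∘L Q) (1 : F →L[ℂ] F) * (R ∘L R)) ∘L ketFst x =
      (R ∘L ketFst (Q (Q x))).adjoint ∘L (R ∘L ketFst x) := fun x => by
    have : (ketFst (F := F) x).adjoint ∘L tensorMap (Q ∘L Q) (1 : F →L[ℂ] F) = (ketFst (Q (Q x))).adjoint := by
      rw [← ContinuousLinearMap.adjoint_adjoint ((ketFst x).adjoint ∘L _)]
      congr 1
      rw [ContinuousLinearMap.adjoint_comp, ContinuousLinearMap.adjoint_adjoint, adjoint_tensorMap,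
        ContinuousLinearMap.adjoint_comp, hQ]
      ext y
      simp [ketFst_apply, tensorMap_pureTensor, ← ContinuousLinearMap.star_eq_adjoint]
    rw [ContinuousLinearMap.adjoint_comp, hR, ← this]
    rfl
  have hsq : ∀ x : E, ‖R ∘L ketFst (F := F) x‖ₑ ^ 2 ≤ ptr (block (R ∘L R) x x) := fun x => by
    refine (enorm_sq_le_hs _).trans_eq ?_
    rw [← ptr_adjoint_comp, ContinuousLinearMap.adjoint_comp, hR]
    rfl
  have hS' : Summable fun i => (ketFst (fixedBasis E i)).adjoint ∘L
      (tensorMap (Q ∘L Q) (1 : F →L[ℂ] F) * (R ∘L R)) ∘L ketFst (fixedBasis E i) := by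
    refine summable_of_tsum_enorm_ne_top
      (ne_top_of_le_ne_top (ENNReal.add_ne_top.2 ⟨hfin (Q ∘L Q), hfin 1⟩) ?_)
    rw [← ENNReal.tsum_add]
    refine ENNReal.tsum_le_tsum fun i => ?_
    rw [e]
    refine le_trans ?_ (add_le_add (hsq _) (hsq _))
    simp only [enorm_sq_eq_ofReal]
    rw [← ENNReal.ofReal_add (by positivity) (by positivity), ← ofReal_norm]
    refine ENNReal.ofReal_le_ofReal ((ContinuousLinearMap.opNorm_comp_le _ _).trans ?_)
    rw [LinearIsometryEquiv.norm_map]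
    simp only [ContinuousLinearMap.comp_apply, one_apply_eq_self]
    nlinarith [sq_nonneg (‖R ∘L ketFst (F := F) (Q (Q (fixedBasis E i)))‖ -
      ‖R ∘L ketFst (F := F) (fixedBasis E i)‖), sq_nonneg (‖R ∘L ketFst (F := F) (Q (Q (fixedBasis E i)))‖),
      sq_nonneg ‖R ∘L ketFst (F := F) (fixedBasis E i)‖]
  refine ContinuousLinearMap.ext fun r' => ext_inner_left ℂ fun r => ?_
  have t1 := ((hS'.hasSum.mapL (ContinuousLinearMap.apply ℂ F r')).mapL (innerSL ℂ r)).tsum_eq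
  have t2 := ((hS.hasSum.mapL (ContinuousLinearMap.apply ℂ F r')).mapL (innerSL ℂ r)).tsum_eq
  simp only [ContinuousLinearMap.apply_apply, innerSL_apply_apply] at t1 t2
  rw [traceFst, ← t1, ← t2]
  have hA : ∀ r : F, hs (R ∘L ketSnd (E := E) r) ≠ ∞ := fun r =>
    ne_top_of_le_ne_top (ENNReal.mul_ne_top (by simp) hRfin) (hs_comp_le' _ _)
  have hAQ : ∀ r : F, hs ((R ∘L ketSnd (E := E) r) ∘L Q) ≠ ∞ := fun r =>
    ne_top_of_le_ne_top (ENNReal.mul_ne_top (by simp) (hA r)) (hs_comp_le' _ _)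
  have hAQQ : ∀ r : F, hs ((R ∘L ketSnd (E := E) r) ∘L (Q ∘L Q)) ≠ ∞ := fun r =>
    ne_top_of_le_ne_top (ENNReal.mul_ne_top (by simp) (hA r)) (hs_comp_le' _ _)
  -- The two sides have the factors `Q` distributed as `(Q², 1)` and `(Q, Q)`. Both become sums over
  -- a basis of the joint space, where they agree because `Q` is self-adjoint.
  have s1 := tsum_inner_adjoint (fixedBasis E) (fixedBasis (HTensor E F)) (hAQQ r) (hA r')
  have s2 := tsum_inner_adjoint (fixedBasis E) (fixedBasis (HTensor E F)) (hAQ r) (hAQ r')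
  simp_rw [e]
  refine Eq.trans (tsum_congr fun i => ?_) (s1.trans (Eq.trans (tsum_congr fun j => ?_)
    (s2.symm.trans (tsum_congr fun i => ?_))))
  · rw [ContinuousLinearMap.comp_apply, ContinuousLinearMap.adjoint_inner_right]; rfl
  · simp only [ContinuousLinearMap.adjoint_comp, hQ, ContinuousLinearMap.comp_apply]
    rw [← ContinuousLinearMap.adjoint_inner_left Q, hQ]
  · rw [inner_block, ContinuousLinearMap.comp_apply (R), ← ContinuousLinearMap.adjoint_inner_left R, hR]
    rfl

end TensorOperators

/-! ### Success probability and score as sums of quadratic forms -/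

section Devices

open scoped ENNReal

variable {E : Type*} [NormedAddCommGroup E] [InnerProductSpace ℂ E] [CompleteSpace E]

theorem HasSum.ofReal_re {ι : Type*} {f : ι → ℂ} {a : ℂ} (h : HasSum f a) (hf : ∀ i, 0 ≤ f i) :
    0 ≤ a ∧ ENNReal.ofReal a.re = ∑' i, ENNReal.ofReal (f i).re := by
  refine ⟨h.nonneg hf, ?_⟩
  have h1 := h.mapL Complex.reCLM
  rw [← ENNReal.ofReal_tsum_of_nonneg (fun i => (Complex.nonneg_iff.1 (hf i)).1) h1.summable]
  exact congrArg _ h1.tsum_eq.symm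

/-- `Tr[Q² R²] = ‖Q R‖²` does not depend on the order of the factors. -/
theorem tsum_qf_comm {Q R : E →L[ℂ] E} (hQ : Q.adjoint = Q) (hR : R.adjoint = R) :
    ∑' j, qf (R ∘L R) (Q (fixedBasis E j)) = ∑' j, qf (Q ∘L Q) (R (fixedBasis E j)) := by
  simp_rw [qf_sqrt hQ, qf_sqrt hR]
  have := hs_adjoint (R ∘L Q)
  rw [ContinuousLinearMap.adjoint_comp, hQ, hR] at this
  exact this.symm

theorem qf_sum_le {P : ℕ → E →L[ℂ] E} (hP : ∀ k, (P k).IsPositive)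
    (hle : ∀ s : Finset ℕ, ∑ k ∈ s, P k ≤ 1) (x : E) : ∑' k, qf (P k) x ≤ ‖x‖ₑ ^ 2 := by
  rw [ENNReal.tsum_eq_iSup_sum]
  refine iSup_le fun s => ?_
  simp_rw [qf]
  rw [← ENNReal.ofReal_sum_of_nonneg fun k _ => re_inner_nonneg (hP k) x, enorm_sq_eq_ofReal]
  refine ENNReal.ofReal_le_ofReal ?_
  have := re_inner_nonneg ((ContinuousLinearMap.le_def _ _).1 (hle s)) x
  simp only [sub_apply, one_apply_eq_self, inner_sub_right, Complex.sub_re,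
    sum_apply, inner_sum, Complex.re_sum] at this
  have h2 : (⟪x, x⟫_ℂ).re = ‖x‖ ^ 2 := by
    rw [inner_self_eq_norm_sq_to_K]; simp [← Complex.ofReal_pow]
  linarith

/-- With `τ = R²`, the inner sum is `Tr[R Pₖ R]`; summing over `k` first and using `∑ₖ Pₖ ≤ I`
leaves at most `‖R‖²` in Hilbert–Schmidt norm. It is needed for arbitrary `τ`, not only for the
marginal. -/
theorem tsum_effect_le {P Q : ℕ → E →L[ℂ] E} (hQ : ∀ k, (Q k).adjoint = Q k)
    (hQP : ∀ k, Q k ∘L Q k = P k) (hP : ∀ k, (P k).IsPositive)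
    (hle : ∀ s : Finset ℕ, ∑ k ∈ s, P k ≤ 1) {τ : E →L[ℂ] E} (hτ : τ.IsPositive) :
    ∑' k, ∑' j, qf τ (Q k (fixedBasis E j)) ≤ ptr τ := by
  obtain ⟨R, hR, rfl⟩ := exists_sqrt hτ
  simp_rw [fun k => tsum_qf_comm (hQ k) hR, hQP]
  rw [ENNReal.tsum_comm, ptr_sqrt hR]
  exact ENNReal.tsum_le_tsum fun j => qf_sum_le hP hle _

theorem tr_effect_mul {Q τ : E →L[ℂ] E} (hQ : Q.adjoint = Q) (hτ : τ.IsPositive) (h : ptr τ ≠ ∞) :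
    0 ≤ tr ((Q ∘L Q) * τ) ∧
      ENNReal.ofReal (tr ((Q ∘L Q) * τ)).re = ∑' j, qf τ (Q (fixedBasis E j)) := by
  obtain ⟨R, hR, rfl⟩ := exists_sqrt hτ
  rw [ptr_sqrt hR] at h
  rw [tsum_qf_comm hQ hR]
  refine HasSum.ofReal_re (tr_mul_sqrt (fixedBasis E) hR h (Q ∘L Q)) fun j => ?_
  have := (ContinuousLinearMap.isPositive_adjoint_comp_self Q).inner_nonneg_right
    (R (fixedBasis E j))
  rwa [hQ] at this

variable {HA HA' HR : Type*}
  [NormedAddCommGroup HA] [InnerProductSpace ℂ HA] [CompleteSpace HA]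
  [NormedAddCommGroup HA'] [InnerProductSpace ℂ HA'] [CompleteSpace HA']
  [NormedAddCommGroup HR] [InnerProductSpace ℂ HR] [CompleteSpace HR]
  {T : Test HA HA' HR} {Ω : HTensor HA' HA →L[ℂ] HTensor HA' HA}

/-- Square roots of the effects and of the prepared states of a device. -/
structure MeasurePrepare.Roots (C : MeasurePrepare HA HA') (Q : ℕ → HA →L[ℂ] HA)
    (R : ℕ → HA' →L[ℂ] HA') : Prop where
  adjoint_effect : ∀ k, (Q k).adjoint = Q k
  effect_eq : ∀ k, Q k ∘L Q k = C.effect k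
  adjoint_prep : ∀ k, (R k).adjoint = R k
  prep_eq : ∀ k, R k ∘L R k = C.prep k

theorem MeasurePrepare.exists_roots (C : MeasurePrepare HA HA') : ∃ Q R, C.Roots Q R := by
  choose Q h1 h2 using fun k => exists_sqrt (C.effect_pos k)
  choose R h3 h4 using fun k => exists_sqrt (C.prep_state k).1
  exact ⟨Q, R, h1, h2, h3, h4⟩

theorem MeasurePrepare.Roots.hs_prep {C : MeasurePrepare HA HA'} {Q R} (h : C.Roots Q R) (k : ℕ) :
    hs (R k) = 1 := by
  rw [← ptr_sqrt (h.adjoint_prep k), h.prep_eq]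
  exact (isState_iff.1 (C.prep_state k)).2

namespace Test

theorem marginal_isState (T : Test HA HA' HR) : IsState T.marginal := traceSnd_isState T.isState_state

theorem ptr_state (T : Test HA HA' HR) : ptr T.state = 1 := (isState_iff.1 T.isState_state).2

/-- The terms of the device output are positive operators of known trace, so the trace of the series
is the sum of the traces. The vectors `Qₖ eⱼ` are those in the formula for the score, so that the
two can be compared termwise. -/
theorem succProb_eq (T : Test HA HA' HR) {C : MeasurePrepare HA HA'} {Q R} (h : C.Roots Q R) :
    0 ≤ T.succProb C ∧
    ENNReal.ofReal (T.succProb C) = ∑' k, ∑' j, qf T.marginal (Q k (fixedBasis HA j)) := by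
  obtain ⟨hm, hm1⟩ := isState_iff.1 T.marginal_isState
  have hk := fun k => tr_effect_mul (h.adjoint_effect k) hm (by simp [hm1])
  simp_rw [h.effect_eq] at hk
  have ek : ∀ k, tr (C.effect k * T.marginal) • C.prep k =
      (((tr (C.effect k * T.marginal)).re : ℝ) : ℂ) • C.prep k := fun k => by
    congr 1
    obtain ⟨-, h2⟩ := Complex.nonneg_iff.1 (hk k).1
    exact Complex.ext rfl (by simp [← h2])
  have hre : ∀ k, 0 ≤ (tr (C.effect k * T.marginal)).re := fun k =>
    (Complex.nonneg_iff.1 (hk k).1).1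
  have hptr : ∀ k, ptr (tr (C.effect k * T.marginal) • C.prep k) =
      ∑' j, qf T.marginal (Q k (fixedBasis HA j)) := fun k => by
    rw [ek, ptr_smul (hre k), (isState_iff.1 (C.prep_state k)).2, (hk k).2, mul_one]
  have hfin : ∑' k, ptr (tr (C.effect k * T.marginal) • C.prep k) ≠ ∞ := by
    simp_rw [hptr]
    exact ne_top_of_le_ne_top (by simp [hm1])
      (tsum_effect_le h.adjoint_effect h.effect_eq C.effect_pos C.effect_sum_le hm)
  obtain ⟨-, h1, -, h3, -⟩ := positive_series
    (fun k => (C.prep_state k).1.smul_of_nonneg (hk k).1) hfin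
  have h4 := tr_eq_ptr h1 (by rwa [h3])
  rw [succProb, MeasurePrepare.apply, h4, h3, Complex.ofReal_re]
  exact ⟨by positivity, by rw [ENNReal.ofReal_toReal hfin]; simp_rw [hptr]⟩

/-- The contribution of one effect and one prepared state to the score. -/
theorem tr_obs_mul (hΩ : T.IsPerformanceOperator Ω)
    (hpos : ∀ x y, 0 ≤ ⟪pureTensor x y, Ω (pureTensor x y)⟫_ℂ)
    {Q : HA →L[ℂ] HA} {R : HA' →L[ℂ] HA'} (hQ : Q.adjoint = Q) (hR : R.adjoint = R)
    (hRf : hs R ≠ ∞) {X : HTensor HA' HR →L[ℂ] HTensor HA' HR}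
    (hX : X = tensorMap (R ∘L R) (traceFst (tensorMap (Q ∘L Q) (1 : HR →L[ℂ] HR) * T.state))) :
    X.IsPositive ∧ ptr X = hs R * ∑' j, qf T.marginal (Q (fixedBasis HA j)) ∧
      0 ≤ tr (T.obs * X) ∧ ENNReal.ofReal (tr (T.obs * X)).re =
        ∑' i, ∑' j, qf Ω (pureTensor (R (fixedBasis HA' i)) (Q (fixedBasis HA j))) := by
  have hσ := T.isState_state.1
  have hσf : ptr T.state ≠ ∞ := by simp [T.ptr_state]
  obtain ⟨-, -, hm⟩ := traceSnd_spec hσ hσf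
  obtain ⟨hfin, hS⟩ := traceFst_mul hσ hσf hQ
  obtain ⟨-, hSpos, -, hSptr, hStr⟩ := positive_series (fun j => block_isPositive hσ _) hfin
  rw [← hS] at hSpos hSptr hStr
  simp_rw [hm] at hSptr hfin
  generalize traceFst (tensorMap (Q ∘L Q) (1 : HR →L[ℂ] HR) * T.state) = S at *
  obtain ⟨L, hL, rfl⟩ := exists_sqrt hSpos
  have hLf : hs L ≠ ∞ := by rw [← ptr_sqrt hL, hSptr]; exact hfin
  -- With `S = L²`, the operator `R² ⊗ S` is the square of the self-adjoint operator `R ⊗ L`, so its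
  -- trace against `O` can be expanded in a product basis.
  have hadj : (tensorMap R L).adjoint = tensorMap R L := by rw [adjoint_tensorMap, hR, hL]
  rw [tensorMap_comp] at hX
  subst hX
  refine ⟨?_, ?_, ?_⟩
  · have := ContinuousLinearMap.isPositive_adjoint_comp_self (tensorMap R L)
    rwa [hadj] at this
  · rw [ptr_sqrt hadj, hs_tensorMap, ← ptr_sqrt hL, hSptr]; rfl
  obtain ⟨d, hd⟩ := exists_prodBasis (fixedBasis HA') (fixedBasis HR)
  have h1 := tr_mul_sqrt d hadj (by rw [hs_tensorMap]; exact ENNReal.mul_ne_top hRf hLf) T.obs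
  simp_rw [hd, tensorMap_pureTensor] at h1
  -- For fixed `i`, the sum over the basis of `R` is the trace of a block of `O` against `S`. Since
  -- `S` is a series of blocks of `σ_AR`, the defining relation of `Ω` then applies to each term.
  have h2 : ∀ i, HasSum (fun m => ⟪pureTensor (R (fixedBasis HA' i)) (L (fixedBasis HR m)),
      T.obs (pureTensor (R (fixedBasis HA' i)) (L (fixedBasis HR m)))⟫_ℂ)
      (tr (block T.obs (R (fixedBasis HA' i)) (R (fixedBasis HA' i)) * (L ∘L L))) := fun i => by
    simp_rw [← inner_block]
    exact tr_mul_sqrt (fixedBasis HR) hL hLf _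
  have h3 := h1.prod_fiberwise h2
  have h4 := fun i => hStr (block T.obs (R (fixedBasis HA' i)) (R (fixedBasis HA' i)))
  simp_rw [← show _ = _ from hΩ _ _ _ _] at h4
  have h5 := fun i => HasSum.ofReal_re (h4 i) (fun j => hpos _ _)
  refine (HasSum.ofReal_re h3 fun i => (h5 i).1).imp_right fun h => h.trans ?_
  exact tsum_congr fun i => (h5 i).2

/-- The single-outcome formula is summed over `k`. Nonnegativity on product vectors lets all the
sums be taken in `ℝ≥0∞`, although `O` has no sign. -/
theorem tr_obs_applyFst (hΩ : T.IsPerformanceOperator Ω)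
    (hpos : ∀ x y, 0 ≤ ⟪pureTensor x y, Ω (pureTensor x y)⟫_ℂ)
    {C : MeasurePrepare HA HA'} {Q R} (h : C.Roots Q R) :
    0 ≤ (tr (T.obs * C.applyFst T.state)).re ∧
    ENNReal.ofReal (tr (T.obs * C.applyFst T.state)).re =
      ∑' k, ∑' i, ∑' j, qf Ω (pureTensor (R k (fixedBasis HA' i)) (Q k (fixedBasis HA j))) := by
  have hk := fun k => tr_obs_mul hΩ hpos (h.adjoint_effect k) (h.adjoint_prep k)
    (by simp [h.hs_prep]) rfl
  have hfin := (tsum_effect_le h.adjoint_effect h.effect_eq C.effect_pos C.effect_sum_le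
    T.marginal_isState.1)
  rw [(isState_iff.1 T.marginal_isState).2] at hfin
  obtain ⟨-, -, -, -, h5⟩ := positive_series (fun k => (hk k).1) (by
    simp_rw [(hk _).2.1, h.hs_prep, one_mul]
    exact ne_top_of_le_ne_top (by simp) hfin)
  obtain ⟨h6, h7⟩ := HasSum.ofReal_re (h5 T.obs) fun k => (hk k).2.2.1
  simp_rw [fun k => (hk k).2.2.2] at h7
  simp_rw [h.effect_eq, h.prep_eq] at h6 h7
  exact ⟨(Complex.nonneg_iff.1 h6).1, h7⟩

end Test

end Devices

/-! ### Hahn–Banach duality for subnormalized families -/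

section Duality

open scoped ENNReal

variable {E Ψ : Type*} [NormedAddCommGroup E] [InnerProductSpace ℂ E] [CompleteSpace E]

/-- The quadratic form `∑ₖ |⟨φₖ, x⟩|²` of a finite family of labelled vectors. -/
noncomputable def frameForm (l : List (Ψ × E)) (x : E) : ℝ := (l.map fun p => ‖⟪p.2, x⟫_ℂ‖ ^ 2).sum

/-- The value `∑ₖ h(ψₖ, φₖ)` of a finite family of labelled vectors. -/
noncomputable def gain (h : Ψ → E → ℝ) (l : List (Ψ × E)) : ℝ := (l.map fun p => h p.1 p.2).sum

/-- All vectors of a family multiplied by a real number. -/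
noncomputable def scaleFamily (c : ℝ) (l : List (Ψ × E)) : List (Ψ × E) :=
  l.map fun p => (p.1, (c : ℂ) • p.2)

theorem frameForm_append (l m : List (Ψ × E)) (x : E) :
    frameForm (l ++ m) x = frameForm l x + frameForm m x := by simp [frameForm]

theorem gain_append (h : Ψ → E → ℝ) (l m : List (Ψ × E)) : gain h (l ++ m) = gain h l + gain h m := by
  simp [gain]

theorem frameForm_scale (c : ℝ) (l : List (Ψ × E)) (x : E) :
    frameForm (scaleFamily c l) x = c ^ 2 * frameForm l x := by
  simp only [frameForm, scaleFamily, List.map_map, ← List.sum_map_mul_left]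
  congr 2
  ext p
  simp [mul_pow]

theorem frameForm_nonneg (l : List (Ψ × E)) (x : E) : 0 ≤ frameForm l x :=
  List.sum_nonneg (by simp only [List.mem_map]; rintro _ ⟨p, -, rfl⟩; positivity)

theorem gain_scale {h : Ψ → E → ℝ} (hs : ∀ ψ (c : ℝ) φ, 0 ≤ c → h ψ ((c : ℂ) • φ) = c ^ 2 * h ψ φ)
    {c : ℝ} (hc : 0 ≤ c) (l : List (Ψ × E)) : gain h (scaleFamily c l) = c ^ 2 * gain h l := by
  simp only [gain, scaleFamily, List.map_map, ← List.sum_map_mul_left]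
  congr 2
  ext p
  exact hs _ _ _ hc

theorem re_inner_le_opNorm (X : E →L[ℂ] E) (x : E) : |(⟪x, X x⟫_ℂ).re| ≤ ‖X‖ * ‖x‖ ^ 2 :=
  calc _ ≤ ‖⟪x, X x⟫_ℂ‖ := Complex.abs_re_le_norm _
    _ ≤ ‖x‖ * ‖X x‖ := norm_inner_le_norm _ _
    _ ≤ ‖x‖ * (‖X‖ * ‖x‖) := by gcongr; exact X.le_opNorm x
    _ = _ := by ring

theorem gain_le_mul {h : Ψ → E → ℝ}
    (hs : ∀ ψ (c : ℝ) φ, 0 ≤ c → h ψ ((c : ℂ) • φ) = c ^ 2 * h ψ φ) {B : ℝ}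
    (hB : ∀ l, (∀ x, frameForm l x ≤ ‖x‖ ^ 2) → gain h l ≤ B) {s : ℝ} (hs0 : 0 ≤ s)
    {l : List (Ψ × E)} (hl : ∀ x, frameForm l x ≤ s * ‖x‖ ^ 2) : gain h l ≤ B * s := by
  have hB0 : 0 ≤ B := by simpa [gain] using hB [] (by simp [frameForm])
  -- Dividing the family by `√u` requires `u > 0`; the limit `u → s` from above then also covers `s
  -- = 0`.
  have key : ∀ u, s < u → gain h l ≤ B * u := fun u hu => by
    have hu0 : 0 < u := hs0.trans_lt hu
    have h1 : (√u⁻¹) ^ 2 = u⁻¹ := Real.sq_sqrt (by positivity)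
    have := hB (scaleFamily (√u⁻¹) l) fun x => by
      rw [frameForm_scale, h1, inv_mul_le_iff₀ hu0]
      exact (hl x).trans (by gcongr)
    rwa [gain_scale hs (by positivity), h1, inv_mul_le_iff₀ hu0, mul_comm] at this
  have hc : Filter.Tendsto (fun u => B * u) (nhdsWithin s (Set.Ioi s)) (nhds (B * s)) :=
    ((continuous_const.mul continuous_id).tendsto s).mono_left nhdsWithin_le_nhds
  exact ge_of_tendsto hc (Filter.eventually_of_mem self_mem_nhdsWithin key)

/-- Feasible pairs for the gauge of an operator. -/
def gaugeSet (h : Ψ → E → ℝ) (B : ℝ) (X : E →L[ℂ] E) : Set ℝ :=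
  {v | ∃ (t : ℝ) (l : List (Ψ × E)), 0 ≤ t ∧
    (∀ x, (⟪x, X x⟫_ℂ).re + frameForm l x ≤ t * ‖x‖ ^ 2) ∧ v = B * t - gain h l}

/-- Finite-dimensional families suffice to build a dual certificate: a form `h` whose total value on
every subnormalized family is at most `B` is dominated by a positive operator of trace at most
`B`. -/
theorem exists_dominating_operator {h : Ψ → E → ℝ}
    (hs : ∀ ψ (c : ℝ) φ, 0 ≤ c → h ψ ((c : ℂ) • φ) = c ^ 2 * h ψ φ) {B : ℝ}
    (hB : ∀ l, (∀ x, frameForm l x ≤ ‖x‖ ^ 2) → gain h l ≤ B) :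
    ∃ Y : E →L[ℂ] E, Y.IsPositive ∧ ptr Y ≤ ENNReal.ofReal B ∧
      ∀ ψ φ, h ψ φ ≤ (⟪φ, Y φ⟫_ℂ).re := by
  have hB0 : 0 ≤ B := by simpa [gain] using hB [] (by simp [frameForm])
  -- If `X + ∑ |φ⟩⟨φ| ≤ t`, then `∑ |φ⟩⟨φ| ≤ t + ‖X‖`, so the gain is at most `B (t + ‖X‖)`.
  have hbdd : ∀ X, BddBelow (gaugeSet h B X) := fun X => by
    refine ⟨-(B * ‖X‖), ?_⟩
    rintro _ ⟨t, l, ht, hl, rfl⟩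
    have := gain_le_mul hs hB (s := t + ‖X‖) (l := l) (by positivity) fun x => by
      have h1 := hl x
      have h2 := (abs_le.1 (re_inner_le_opNorm X x)).1
      linarith
    linarith
  have hne : ∀ X, (gaugeSet h B X).Nonempty := fun X =>
    ⟨_, ‖X‖, [], norm_nonneg _, fun x => by
      simpa [frameForm] using (abs_le.1 (re_inner_le_opNorm X x)).2, rfl⟩
  have hhom_le : ∀ c : ℝ, 0 < c → ∀ X, sInf (gaugeSet h B (c • X)) ≤ c * sInf (gaugeSet h B X) := by
    intro c hc X
    rw [← div_le_iff₀' hc]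
    refine le_csInf (hne X) ?_
    rintro _ ⟨t, l, ht, hl, rfl⟩
    rw [div_le_iff₀' hc]
    refine csInf_le (hbdd _) ⟨c * t, scaleFamily √c l, by positivity, fun x => ?_, ?_⟩
    · rw [frameForm_scale, Real.sq_sqrt hc.le]
      have := mul_le_mul_of_nonneg_left (hl x) hc.le
      simp only [smul_apply, inner_smul_right_eq_smul, Complex.smul_re,
        smul_eq_mul]
      linarith
    · rw [gain_scale hs (by positivity), Real.sq_sqrt hc.le]; ring
  have hhom : ∀ c : ℝ, 0 < c → ∀ X, sInf (gaugeSet h B (c • X)) = c * sInf (gaugeSet h B X) := by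
    intro c hc X
    refine le_antisymm (hhom_le c hc X) ?_
    have := hhom_le c⁻¹ (by positivity) (c • X)
    rwa [smul_smul, inv_mul_cancel₀ hc.ne', one_smul, le_inv_mul_iff₀ hc] at this
  have hadd : ∀ X Y, sInf (gaugeSet h B (X + Y)) ≤ sInf (gaugeSet h B X) + sInf (gaugeSet h B Y) := by
    intro X Y
    rw [← sub_le_iff_le_add]
    refine le_csInf (hne X) ?_
    rintro _ ⟨t, l, ht, hl, rfl⟩
    rw [sub_le_comm]
    refine le_csInf (hne Y) ?_
    rintro _ ⟨u, m, hu, hm, rfl⟩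
    rw [sub_le_iff_le_add]
    refine csInf_le (hbdd _) ⟨t + u, l ++ m, by positivity, fun x => ?_, ?_⟩
    · rw [frameForm_append]
      have := hl x
      have := hm x
      simp only [add_apply, inner_add_right, Complex.add_re]
      linarith
    · rw [gain_append]; ring
  -- Hahn–Banach from the zero subspace: the infimum over `gaugeSet` is sublinear, and homogeneity
  -- with factor `2` forces it to vanish at `0`.
  obtain ⟨g, -, hg⟩ := exists_extension_of_le_sublinear (⟨⊥, 0⟩ : (E →L[ℂ] E) →ₗ.[ℝ] ℝ)
    (fun X => sInf (gaugeSet h B X)) hhom hadd (by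
      rintro ⟨x, hx⟩
      obtain rfl := (Submodule.mem_bot ℝ).1 hx
      have := hhom 2 (by norm_num) 0
      rw [smul_zero] at this
      have h0 : sInf (gaugeSet h B 0) = 0 := by linarith
      simp [h0])
  have hgle : ∀ X (t : ℝ), 0 ≤ t → (∀ x, (⟪x, X x⟫_ℂ).re ≤ t * ‖x‖ ^ 2) → g X ≤ B * t :=
    fun X t ht hX => (hg X).trans (csInf_le (hbdd _) ⟨t, [], ht, by simpa [frameForm] using hX,
      by simp [gain]⟩)
  -- The constraint sees only the real part of the quadratic form, so `g` kills skew-adjoint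
  -- operators. This makes the complex extension of `g` real on `|v⟩⟨v|`.
  have hgskew : ∀ X, (∀ x, (⟪x, X x⟫_ℂ).re = 0) → g X = 0 := fun X hX => by
    have h1 := hgle X 0 le_rfl (by simp [hX])
    have h2 := hgle (-X) 0 le_rfl (by simp [hX])
    rw [map_neg] at h2
    linarith
  have hgnorm : ∀ X, ‖g X‖ ≤ B * ‖X‖ := fun X => by
    rw [Real.norm_eq_abs, abs_le]
    have h1 := hgle X ‖X‖ (norm_nonneg _) fun x => (abs_le.1 (re_inner_le_opNorm X x)).2
    have h2 := hgle (-X) ‖X‖ (norm_nonneg _) fun x => by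
      have := (abs_le.1 (re_inner_le_opNorm X x)).1
      simp only [neg_apply, inner_neg_right, Complex.neg_re]
      linarith
    rw [map_neg] at h2
    constructor <;> linarith
  let gR : StrongDual ℝ (E →L[ℂ] E) := g.mkContinuous B hgnorm
  let gC : StrongDual ℂ (E →L[ℂ] E) := gR.extendRCLike
  let R : E → E →L[ℂ] E := fun v => InnerProductSpace.rankOne ℂ v v
  have hR : ∀ v x, (⟪x, R v x⟫_ℂ).re = ‖⟪v, x⟫_ℂ‖ ^ 2 := fun v x => by
    simp only [R, InnerProductSpace.rankOne_apply, inner_smul_right]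
    rw [← inner_conj_symm x v, Complex.mul_conj']
    simp [← Complex.ofReal_pow]
  -- `Y` records `g` on rank-one operators. The functional `g` need not be a trace against `Y` on
  -- all operators, but only these values are required.
  let Y := InnerProductSpace.continuousLinearMapOfBilin (𝕜 := ℂ)
    ((ContinuousLinearMap.compL ℂ E (E →L[ℂ] E) ℂ gC).comp (InnerProductSpace.rankOne ℂ).flip)
  have hY : ∀ v, ⟪Y v, v⟫_ℂ = (g (R v) : ℂ) := fun v => by
    rw [InnerProductSpace.continuousLinearMapOfBilin_apply]
    change gR.extendRCLike (R v) = _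
    rw [StrongDual.extendRCLike_apply]
    have : gR ((RCLike.I : ℂ) • R v) = 0 := hgskew _ fun x => by
      simp only [R, InnerProductSpace.rankOne_apply, smul_apply,
        inner_smul_right]
      rw [← inner_conj_symm x v, Complex.mul_conj']
      simp [← Complex.ofReal_pow]
    rw [this]
    simp [gR]
  have hYpos : Y.IsPositive := by
    rw [ContinuousLinearMap.isPositive_iff_complex]
    intro x
    rw [hY]
    have := hgle (-(R x)) 0 le_rfl fun y => by
      simp only [neg_apply, inner_neg_right, Complex.neg_re, hR]
      rw [zero_mul, neg_nonpos]; positivity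
    rw [map_neg] at this
    simp only [RCLike.re_to_complex, Complex.ofReal_re]
    refine ⟨trivial, by linarith⟩
  have hY' : ∀ v, (⟪v, Y v⟫_ℂ).re = g (R v) := fun v => by
    rw [← hYpos.inner_left_eq_inner_right, hY, Complex.ofReal_re]
  refine ⟨Y, hYpos, ?_, fun ψ φ => ?_⟩
  · rw [ptr, ENNReal.tsum_eq_iSup_sum]
    refine iSup_le fun s => ?_
    simp_rw [qf]
    rw [← ENNReal.ofReal_sum_of_nonneg fun k _ => re_inner_nonneg hYpos _]
    refine ENNReal.ofReal_le_ofReal ?_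
    simp_rw [hY', ← map_sum]
    -- By Bessel, a finite sum of basis projections is at most `I`, on which `g` costs at most `B`.
    refine (hgle _ 1 zero_le_one fun x => ?_).trans_eq (mul_one B)
    simp only [sum_apply, inner_sum, Complex.re_sum, hR, one_mul]
    exact (fixedBasis E).orthonormal.sum_inner_products_le _
  · rw [hY']
    -- The operator `-|φ⟩⟨φ|` plus the one-vector family `φ` is zero, so `t = 0` is feasible and the
    -- gauge is at most `-h ψ φ`.
    have := (hg (-(R φ))).trans (csInf_le (hbdd _) ⟨0, [(ψ, φ)], le_rfl, fun x => ?_, rfl⟩)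
    · rw [map_neg] at this
      simp only [gain, List.map_cons, List.map_nil, List.sum_cons, List.sum_nil] at this
      linarith
    · simp [frameForm, hR]

end Duality

/-! ### Domination on product vectors and the objective -/

section Domination

open scoped ENNReal

variable {E F : Type*}
  [NormedAddCommGroup E] [InnerProductSpace ℂ E] [CompleteSpace E]
  [NormedAddCommGroup F] [InnerProductSpace ℂ F] [CompleteSpace F]
  {Ω : HTensor E F →L[ℂ] HTensor E F}

theorem pureTensor_smul (a b : ℂ) (x : E) (y : F) :
    pureTensor (a • x) (b • y) = (a * b) • pureTensor x y := by
  rw [← ketFst_apply, map_smul, ketFst_apply, ← ketSnd_apply, map_smul, ketSnd_apply, smul_smul,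
    mul_comm]

theorem pureTensor_add (x : E) (y y' : F) :
    pureTensor x (y + y') = pureTensor x y + pureTensor x y' := by
  simp_rw [← ketFst_apply, map_add]

theorem pureTensor_sub (x : E) (y y' : F) :
    pureTensor x (y - y') = pureTensor x y - pureTensor x y' := by
  simp_rw [← ketFst_apply, map_sub]

theorem qf_smul (T : E →L[ℂ] E) (c : ℂ) (x : E) : qf T (c • x) = ‖c‖ₑ ^ 2 * qf T x := by
  rw [qf, qf, enorm_sq_eq_ofReal, ← ENNReal.ofReal_mul (by positivity), map_smul, inner_smul_left,
    inner_smul_right, ← mul_assoc, Complex.conj_mul', ← Complex.ofReal_pow, Complex.re_ofReal_mul]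

theorem continuous_pureTensor : Continuous fun p : E × F => pureTensor p.1 p.2 := by
  have h : Continuous fun p : E × F =>
      ((TensorProduct.mkL ℂ E F p.1 p.2 : E ⊗[ℂ] F) : HTensor E F) :=
    (UniformSpace.Completion.continuous_coe _).comp (by fun_prop)
  exact h

theorem PosSemidef.sum_nonneg {n : Type*} {M : Matrix n n ℂ} (hM : M.PosSemidef) (s : Finset n)
    (w : n → ℂ) : 0 ≤ ∑ p ∈ s, ∑ q ∈ s, star (w p) * M p q * w q := by
  have h := (hM.submatrix (Subtype.val : s → n)).dotProduct_mulVec_nonneg (fun p => w p)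
  simp only [dotProduct, Matrix.mulVec, Finset.mul_sum, Matrix.submatrix_apply, Pi.star_apply] at h
  rw [← Finset.sum_coe_sort]
  simp_rw [← Finset.sum_coe_sort s]
  simpa only [mul_assoc] using h

theorem pureTensor_sum {ι κ : Type*} (s : Finset ι) (t : Finset κ) (x : ι → E) (y : κ → F) :
    pureTensor (∑ i ∈ s, x i) (∑ a ∈ t, y a) = ∑ i ∈ s, ∑ a ∈ t, pureTensor (x i) (y a) := by
  rw [← ketSnd_apply, map_sum]
  simp_rw [ketSnd_apply, ← ketFst_apply, map_sum]

/-- Transposing the second factor conjugates its coefficients: the expectation of `Ω` at `u ⊗ v` is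
that of the partial transpose at `u ⊗ v̄`. -/
theorem IsPPT.inner_nonneg_of_sum (h : IsPPT Ω) (s : Finset (basisIndex E))
    (t : Finset (basisIndex F)) (u : basisIndex E → ℂ) (v : basisIndex F → ℂ) {x : E} {y : F}
    (hx : x = ∑ i ∈ s, u i • fixedBasis E i) (hy : y = ∑ a ∈ t, v a • fixedBasis F a) :
    0 ≤ ⟪pureTensor x y, Ω (pureTensor x y)⟫_ℂ := by
  convert PosSemidef.sum_nonneg h (s ×ˢ t) (fun p => u p.1 * star (v p.2)) using 1
  simp_rw [hx, hy, pureTensor_sum, pureTensor_smul, map_sum, sum_inner, inner_sum, map_smul,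
    inner_smul_left, inner_smul_right, Finset.sum_product, partialTranspose]
  refine Finset.sum_congr rfl fun i _ => ?_
  calc _ = ∑ a ∈ t, ∑ b ∈ t, ∑ j ∈ s, (starRingEnd ℂ) (u i * v a) * (u j * v b *
        ⟪pureTensor (fixedBasis E i) (fixedBasis F a),
          Ω (pureTensor (fixedBasis E j) (fixedBasis F b))⟫_ℂ) := by
        exact Finset.sum_congr rfl fun a _ => Finset.sum_comm
    _ = ∑ b ∈ t, ∑ a ∈ t, ∑ j ∈ s, (starRingEnd ℂ) (u i * v a) * (u j * v b *
        ⟪pureTensor (fixedBasis E i) (fixedBasis F a),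
          Ω (pureTensor (fixedBasis E j) (fixedBasis F b))⟫_ℂ) := Finset.sum_comm
    _ = _ := by
        refine Finset.sum_congr rfl fun b _ => ?_
        rw [Finset.sum_comm]
        refine Finset.sum_congr rfl fun j _ => Finset.sum_congr rfl fun a _ => ?_
        simp only [map_mul, star_mul', RCLike.star_def]
        ring_nf
        simp only [Complex.conj_conj]
        ring

/-- A positive partial transpose makes the expectation values on product vectors nonnegative. -/
theorem IsPPT.inner_nonneg (h : IsPPT Ω) (x : E) (y : F) :
    0 ≤ ⟪pureTensor x y, Ω (pureTensor x y)⟫_ℂ := by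
  -- Finite combinations of basis vectors are dense and the condition is closed.
  have hclosed : IsClosed {p : E × F |
      0 ≤ ⟪pureTensor p.1 p.2, Ω (pureTensor p.1 p.2)⟫_ℂ} :=
    isClosed_le continuous_const
      (continuous_pureTensor.inner (Ω.continuous.comp continuous_pureTensor))
  have hd : Dense (((Submodule.span ℂ (Set.range (fixedBasis E)) : Submodule ℂ E) : Set E) ×ˢ
      ((Submodule.span ℂ (Set.range (fixedBasis F)) : Submodule ℂ F) : Set F)) :=
    ((Submodule.dense_iff_topologicalClosure_eq_top).2 (fixedBasis E).dense_span).prod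
      ((Submodule.dense_iff_topologicalClosure_eq_top).2 (fixedBasis F).dense_span)
  have hsub : (((Submodule.span ℂ (Set.range (fixedBasis E)) : Submodule ℂ E) : Set E) ×ˢ
      ((Submodule.span ℂ (Set.range (fixedBasis F)) : Submodule ℂ F) : Set F)) ⊆ {p : E × F |
      0 ≤ ⟪pureTensor p.1 p.2, Ω (pureTensor p.1 p.2)⟫_ℂ} := by
    rintro ⟨x, y⟩ ⟨hx, hy⟩
    obtain ⟨u, hu⟩ := Finsupp.mem_span_range_iff_exists_finsupp.1 hx
    obtain ⟨v, hv⟩ := Finsupp.mem_span_range_iff_exists_finsupp.1 hy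
    exact h.inner_nonneg_of_sum u.support v.support u v hu.symm hv.symm
  have hmem := hclosed.closure_subset_iff.2 hsub (hd (x, y))
  rwa [Set.mem_ofPred_eq] at hmem

theorem hasSum_inner_ketFst {ι : Type*} (b : HilbertBasis ι ℂ E) (u v : HTensor E F) :
    HasSum (fun i => ⟪(ketFst (b i)).adjoint u, (ketFst (b i)).adjoint v⟫_ℂ) ⟪u, v⟫_ℂ := by
  obtain ⟨d, hd⟩ := exists_prodBasis b (fixedBasis F)
  refine (d.hasSum_inner_mul_inner u v).prod_fiberwise fun i => ?_
  have := (fixedBasis F).hasSum_inner_mul_inner ((ketFst (b i)).adjoint u) ((ketFst (b i)).adjoint v)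
  simpa only [ContinuousLinearMap.adjoint_inner_left, ContinuousLinearMap.adjoint_inner_right,
    ketFst_apply, hd] using this

/-- `Ω ≤ c (I ⊗ τ)` on product vectors. -/
def Dominated (Ω : HTensor E F →L[ℂ] HTensor E F) (c : ℝ) (τ : F →L[ℂ] F) : Prop :=
  ∀ x y, ‖x‖ = 1 → (⟪pureTensor x y, Ω (pureTensor x y)⟫_ℂ).re ≤ c * (⟪y, τ y⟫_ℂ).re

theorem block_self_isPositive (hpos : ∀ x y, 0 ≤ ⟪pureTensor x y, Ω (pureTensor x y)⟫_ℂ)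
    (x : E) : (block Ω x x).IsPositive := by
  rw [ContinuousLinearMap.isPositive_iff_complex]
  intro y
  have h := Complex.nonneg_iff.1 (hpos x y)
  rw [← inner_block] at h
  have h2 : ⟪block Ω x x y, y⟫_ℂ = ((⟪y, block Ω x x y⟫_ℂ).re : ℂ) := by
    rw [← inner_conj_symm]
    exact Complex.ext rfl (by rw [Complex.conj_im, ← h.2]; simp)
  rw [h2]
  exact ⟨by simp, by simpa using h.1⟩

theorem IsPositive.apply_eq_zero {T : F →L[ℂ] F} (hT : T.IsPositive) {y : F}
    (h : (⟪y, T y⟫_ℂ).re ≤ 0) : T y = 0 := by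
  obtain ⟨R, hR, rfl⟩ := exists_sqrt hT
  have h1 := qf_sqrt hR y
  rw [qf, ENNReal.ofReal_of_nonpos h] at h1
  have h2 : R y = 0 := by simpa using h1.symm
  simp [h2]

/-- Each diagonal block of `Ω` is positive, so a vanishing expectation at `φ` makes it annihilate
`φ`. Polarization in `x` extends this to off-diagonal blocks; `Ω` itself need not be positive. -/
theorem apply_pureTensor_eq_zero (hpos : ∀ x y, 0 ≤ ⟪pureTensor x y, Ω (pureTensor x y)⟫_ℂ)
    {φ : F}
    (h : ∀ x, (⟪pureTensor x φ, Ω (pureTensor x φ)⟫_ℂ).re ≤ 0) (x : E) :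
    Ω (pureTensor x φ) = 0 := by
  have h1 : ∀ x y, ⟪pureTensor x y, Ω (pureTensor x φ)⟫_ℂ = 0 := fun x y => by
    rw [← inner_block, IsPositive.apply_eq_zero (block_self_isPositive hpos x)
      (by rw [inner_block]; exact h x), inner_zero_right]
  refine ext_inner_pureTensor fun z y => ?_
  rw [inner_zero_right]
  have h2 : ((ketSnd y).adjoint ∘L Ω ∘L ketSnd φ : E →L[ℂ] E) = 0 := by
    have := (inner_map_self_eq_zero
      (((ketSnd y).adjoint ∘L Ω ∘L ketSnd φ : E →L[ℂ] E) : E →ₗ[ℂ] E)).1 fun x => by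
      rw [← inner_conj_symm]
      simp only [ContinuousLinearMap.coe_coe, ContinuousLinearMap.comp_apply]
      rw [ketSnd_adjoint_inner, ketSnd_apply, h1, map_zero]
    exact ContinuousLinearMap.coe_injective this
  have h3 := congrArg (fun S : E →L[ℂ] E => ⟪z, S x⟫_ℂ) h2
  simpa [ContinuousLinearMap.adjoint_inner_right, ketSnd_apply] using h3

theorem re_inner_pureTensor_le {c : ℝ} {τ : F →L[ℂ] F} (h : Dominated Ω c τ) (x : E) (y : F) :
    (⟪pureTensor x y, Ω (pureTensor x y)⟫_ℂ).re ≤ ‖x‖ ^ 2 * (c * (⟪y, τ y⟫_ℂ).re) := by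
  by_cases hx : x = 0
  · subst hx
    simp [← ketSnd_apply]
  have h1 := h ((‖x‖⁻¹ : ℂ) • x) y (by simp [norm_smul, hx])
  have h2 : x = (‖x‖ : ℂ) • (‖x‖⁻¹ : ℂ) • x := by
    rw [smul_smul, mul_inv_cancel₀ (by simpa using hx), one_smul]
  have h3 : pureTensor x y = (‖x‖ : ℂ) • pureTensor ((‖x‖⁻¹ : ℂ) • x) y := by
    conv_lhs => rw [h2, ← ketSnd_apply, map_smul, ketSnd_apply]
  rw [h3, map_smul, inner_smul_left, inner_smul_right, Complex.conj_ofReal, ← mul_assoc,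
    ← Complex.ofReal_mul, Complex.re_ofReal_mul, ← sq]
  gcongr

theorem Dominated.apply_eq_zero (hpos : ∀ x y, 0 ≤ ⟪pureTensor x y, Ω (pureTensor x y)⟫_ℂ)
    {c : ℝ} {τ : F →L[ℂ] F} (h : Dominated Ω c τ) {φ : F}
    (hφ : τ φ = 0) (x : E) : Ω (pureTensor x φ) = 0 :=
  apply_pureTensor_eq_zero hpos (fun x => by
    simpa [hφ] using re_inner_pureTensor_le h x φ) x

theorem Dominated.eq_zero (hpos : ∀ x y, 0 ≤ ⟪pureTensor x y, Ω (pureTensor x y)⟫_ℂ)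
    {τ : F →L[ℂ] F} (h : Dominated Ω 0 τ) : Ω = 0 :=
  ext_pureTensor fun x y => apply_pureTensor_eq_zero hpos (fun x => by
    simpa using re_inner_pureTensor_le h x y) x

/-- A vector in the kernel of `I ⊗ τ` has all its slices in the kernel of `τ`, and domination makes
`Ω` kill every product vector with such a second factor. Summing over the slices shows that `Ω`
kills the vector. -/
theorem Dominated.mem_admissible (hpos : ∀ x y, 0 ≤ ⟪pureTensor x y, Ω (pureTensor x y)⟫_ℂ)
    {c : ℝ} {τ : F →L[ℂ] F} (hτ : IsState τ) (h : Dominated Ω c τ) :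
    τ ∈ admissible Ω := by
  refine ⟨hτ, Submodule.orthogonal_le fun v hv => ?_⟩
  rw [LinearMap.mem_ker, ContinuousLinearMap.coe_coe] at hv ⊢
  refine ext_inner_left ℂ fun w => ?_
  rw [← ContinuousLinearMap.adjoint_inner_left, inner_zero_right]
  refine (hasSum_inner_ketFst (fixedBasis E) (Ω.adjoint w) v).unique ?_
  convert hasSum_zero with i
  have h1 : τ ((ketFst (fixedBasis E i)).adjoint v) = 0 := by
    refine ext_inner_left ℂ fun y => ?_
    rw [← hτ.1.inner_left_eq_inner_right, ketFst_adjoint_inner, inner_zero_right]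
    have := congrArg (fun z => ⟪pureTensor (fixedBasis E i) y, z⟫_ℂ) hv
    rw [inner_zero_right, ← ContinuousLinearMap.adjoint_inner_left, adjoint_tensorMap,
      tensorMap_pureTensor, hτ.1.isSelfAdjoint.adjoint_eq] at this
    simpa [← ContinuousLinearMap.star_eq_adjoint] using this
  rw [ContinuousLinearMap.adjoint_inner_left, ContinuousLinearMap.adjoint_inner_left, ketFst_apply,
    h.apply_eq_zero hpos h1, inner_zero_right]

/-- Kernels of bounded operators are closed, so inclusion of supports is the reverse inclusion of
kernels. -/
theorem mem_admissible_apply_eq_zero {τ : F →L[ℂ] F} (hτ : τ ∈ admissible Ω) {φ : F}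
    (hφ : τ φ = 0) (x : E) : Ω (pureTensor x φ) = 0 := by
  have h1 : LinearMap.ker (tensorMap (1 : E →L[ℂ] E) τ : HTensor E F →ₗ[ℂ] HTensor E F) ≤
      LinearMap.ker (Ω : HTensor E F →ₗ[ℂ] HTensor E F) := by
    have h2 := Submodule.orthogonal_le hτ.2
    rw [support, support] at h2
    have hc : ∀ S : HTensor E F →L[ℂ] HTensor E F,
        (LinearMap.ker (S : HTensor E F →ₗ[ℂ] HTensor E F))ᗮᗮ =
          LinearMap.ker (S : HTensor E F →ₗ[ℂ] HTensor E F) := fun S => by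
      rw [Submodule.orthogonal_orthogonal_eq_closure]
      exact S.isClosed_ker.submodule_topologicalClosure_eq
    rwa [hc, hc] at h2
  refine h1 ?_
  rw [LinearMap.mem_ker, ContinuousLinearMap.coe_coe, tensorMap_pureTensor, hφ, ← ketFst_apply,
    map_zero]

theorem sqrt_spec {τ : F →L[ℂ] F} (hτ : τ.IsPositive) :
    (CFC.sqrt τ).adjoint = CFC.sqrt τ ∧ CFC.sqrt τ ∘L CFC.sqrt τ = τ :=
  ⟨(IsSelfAdjoint.of_nonneg (CFC.sqrt_nonneg τ)).star_eq,
    CFC.sqrt_mul_sqrt_self τ ((ContinuousLinearMap.nonneg_iff_isPositive τ).2 hτ)⟩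

theorem re_inner_eq_norm_sqrt_sq {τ : F →L[ℂ] F} (hτ : τ.IsPositive) (y : F) :
    (⟪y, τ y⟫_ℂ).re = ‖CFC.sqrt τ y‖ ^ 2 := by
  obtain ⟨h1, h2⟩ := sqrt_spec hτ
  conv_lhs => rw [← h2]
  rw [ContinuousLinearMap.comp_apply, ← ContinuousLinearMap.adjoint_inner_left, h1,
    inner_self_eq_norm_sq_to_K]
  simp [← Complex.ofReal_pow]

theorem mem_invSqrtGraph {τ : F →L[ℂ] F} (α : (invSqrt τ).domain) :
    ((α : F), invSqrt τ α) ∈ invSqrtGraph τ := by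
  rw [← invSqrt_graph]
  exact LinearPMap.mem_graph _ α

/-- `τ^{1/2} τ^{-1/2} α` is an orthogonal projection of `α`: the difference lies in the kernel of
`τ^{1/2}`, which is orthogonal to its range. -/
theorem norm_sqrt_invSqrt_le {τ : F →L[ℂ] F} (hτ : τ.IsPositive) (α : (invSqrt τ).domain) :
    ‖CFC.sqrt τ (invSqrt τ α)‖ ≤ ‖(α : F)‖ := by
  obtain ⟨-, h⟩ := mem_invSqrtGraph α
  simp only at h
  set y := invSqrt τ α
  have h1 : ⟪CFC.sqrt τ y, (α : F) - CFC.sqrt τ y⟫_ℂ = 0 := by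
    rw [← (sqrt_spec hτ).1, ContinuousLinearMap.adjoint_inner_left, (sqrt_spec hτ).1, h,
      inner_zero_right]
  rw [inner_sub_right, sub_eq_zero, inner_self_eq_norm_sq_to_K] at h1
  have h2 := norm_inner_le_norm (𝕜 := ℂ) (CFC.sqrt τ y) (α : F)
  rw [h1] at h2
  simp only [norm_pow, RCLike.norm_ofReal, abs_norm] at h2
  by_contra! hlt
  nlinarith [norm_nonneg (α : F)]

theorem Dominated.objective_le {c : ℝ} (hc : 0 ≤ c) {τ : F →L[ℂ] F} (hτ : τ.IsPositive)
    (h : Dominated Ω c τ) : objective Ω τ ≤ (c : EReal) := by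
  refine iSup_le fun x => iSup_le fun α => iSup_le fun hx => iSup_le fun hα => ?_
  refine EReal.coe_le_coe_iff.2 ((h _ _ hx).trans ?_)
  rw [re_inner_eq_norm_sqrt_sq hτ]
  have h1 := norm_sqrt_invSqrt_le hτ α
  rw [hα] at h1
  exact mul_le_of_le_one_right hc (pow_le_one₀ (norm_nonneg _) h1)

/-- Every vector that `τ` does not annihilate gives, after normalization, a unit vector in the
domain of `τ^{-1/2}`. -/
theorem exists_invSqrt_eq {τ : F →L[ℂ] F} (hτ : τ.IsPositive) {φ : F} (hφ : τ φ ≠ 0) :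
    ∃ (α : (invSqrt τ).domain) (k : F), ‖(α : F)‖ = 1 ∧ τ k = 0 ∧ CFC.sqrt τ φ ≠ 0 ∧
      φ = (‖CFC.sqrt τ φ‖ : ℂ) • invSqrt τ α + k := by
  obtain ⟨h1, h2⟩ := sqrt_spec hτ
  set R := CFC.sqrt τ with hRdef
  have hne : R φ ≠ 0 := fun h0 => hφ (by rw [← h2]; simp [h0])
  let K := LinearMap.ker (R : F →ₗ[ℂ] F)
  have : CompleteSpace K := R.isClosed_ker.completeSpace_coe
  -- Split `φ = k + y` along the kernel of `R = τ^{1/2}`. The unit vector `R y / ‖R y‖` is the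
  -- required `α`, with `τ^{-1/2} α = y / ‖R y‖`.
  obtain ⟨k, hk, y, hy, rfl⟩ : ∃ k ∈ K, ∃ y ∈ Kᗮ, φ = k + y :=
    K.exists_add_mem_mem_orthogonal φ
  have hk0 : R k = 0 := hk
  rw [map_add, hk0, zero_add] at hne ⊢
  have hmem : (((‖R y‖ : ℂ)⁻¹ • R y, (‖R y‖ : ℂ)⁻¹ • y) : F × F) ∈ (invSqrt τ).graph := by
    rw [invSqrt_graph]
    exact ⟨Submodule.smul_mem _ _ hy, by simp [← hRdef]⟩
  obtain ⟨α, hα1, hα2⟩ := LinearPMap.mem_graph_iff _ |>.1 hmem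
  refine ⟨α, k, ?_, by rw [← h2]; simp [hk0], hne, ?_⟩
  · rw [hα1]; simp [norm_smul, hne]
  · rw [hα2, smul_smul, mul_inv_cancel₀ (by simpa using hne), one_smul, add_comm]

theorem le_objective {τ : F →L[ℂ] F} {x : E} (hx : ‖x‖ = 1) {α : (invSqrt τ).domain}
    (hα : ‖(α : F)‖ = 1) :
    (((⟪pureTensor x (invSqrt τ α), Ω (pureTensor x (invSqrt τ α))⟫_ℂ).re : ℝ) : EReal) ≤
      objective Ω τ :=
  le_iSup_of_le x (le_iSup_of_le α (le_iSup_of_le hx (le_iSup_of_le hα le_rfl)))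

/-- The converse of `Dominated.objective_le`. Any `φ` outside the kernel of `τ` is `s τ^{-1/2} α +
k` with `s² = ⟪φ, τ φ⟫` and `τ k = 0`; admissibility removes `k` from the expectation of `Ω`. -/
theorem dominated_of_objective_le
    (hpos : ∀ x y, 0 ≤ ⟪pureTensor x y, Ω (pureTensor x y)⟫_ℂ) {c : ℝ} {τ : F →L[ℂ] F}
    (hτ : τ ∈ admissible Ω) (h : objective Ω τ ≤ (c : EReal)) : Dominated Ω c τ := by
  intro x φ hx
  by_cases hφ : τ φ = 0
  · rw [mem_admissible_apply_eq_zero hτ hφ, hφ]; simp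
  obtain ⟨α, k, hα, hk, -, hdec⟩ := exists_invSqrt_eq hτ.1.1 hφ
  have h1 := EReal.coe_le_coe_iff.1 ((le_objective hx hα).trans h)
  rw [re_inner_eq_norm_sqrt_sq hτ.1.1]
  set s := ‖CFC.sqrt τ φ‖
  set y := invSqrt τ α
  have hΩk : block Ω x x k = 0 := by
    refine ext_inner_left ℂ fun z => ?_
    rw [inner_block, mem_admissible_apply_eq_zero hτ hk, inner_zero_right, inner_zero_right]
  have hb := block_self_isPositive hpos x
  have h2 : ⟪φ, block Ω x x φ⟫_ℂ = (s ^ 2 : ℝ) * ⟪y, block Ω x x y⟫_ℂ := by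
    rw [hdec, map_add, hΩk, add_zero, inner_add_left, ← hb.inner_left_eq_inner_right k, hΩk,
      inner_zero_left, add_zero, map_smul, inner_smul_left, inner_smul_right, Complex.conj_ofReal]
    push_cast; ring
  rw [← inner_block, h2, Complex.re_ofReal_mul, inner_block, mul_comm c]
  gcongr

theorem IsState.exists_apply_ne_zero {τ : F →L[ℂ] F} (hτ : IsState τ) : ∃ φ, τ φ ≠ 0 := by
  by_contra! h
  have h2 := (isState_iff.1 hτ).2
  simp [ptr, qf, h] at h2

/-- A state is nonzero, so the domain of `τ^{-1/2}` contains a unit vector; the supremum is then not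
over an empty set and cannot be `⊥`. -/
theorem objective_nonneg (hpos : ∀ x y, 0 ≤ ⟪pureTensor x y, Ω (pureTensor x y)⟫_ℂ)
    {τ : F →L[ℂ] F} (hτ : IsState τ) {x : E} (hx : ‖x‖ = 1) : 0 ≤ objective Ω τ := by
  obtain ⟨φ, hφ⟩ := hτ.exists_apply_ne_zero
  obtain ⟨α, -, hα, -⟩ := exists_invSqrt_eq hτ.1 hφ
  refine le_trans ?_ (le_objective hx hα)
  exact_mod_cast (Complex.nonneg_iff.1 (hpos _ _)).1

/-- Normalizing a dominating operator. -/
theorem exists_admissible_of_dominated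
    (hpos : ∀ x y, 0 ≤ ⟪pureTensor x y, Ω (pureTensor x y)⟫_ℂ) (hΩ : Ω ≠ 0) {Y : F →L[ℂ] F}
    (hY : Y.IsPositive) (hfin : ptr Y ≠ ∞) (h : Dominated Ω 1 Y) :
    ∃ τ ∈ admissible Ω, objective Ω τ ≤ ((ptr Y).toReal : EReal) := by
  have ht : 0 < (ptr Y).toReal := by
    refine ENNReal.toReal_pos (fun h0 => hΩ ?_) hfin
    have h1 : Y = 0 := by simpa [h0] using enorm_le_ptr hY
    subst h1
    refine Dominated.eq_zero hpos (τ := 0) fun x y hx => ?_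
    simpa using h x y hx
  set t := (ptr Y).toReal with htdef
  have hst : IsState (((t⁻¹ : ℝ) : ℂ) • Y) := by
    refine isState_iff.2 ⟨hY.smul_of_nonneg (by simpa using ht.le), ?_⟩
    rw [ptr_smul (by positivity), ← ENNReal.ofReal_toReal hfin, ← htdef,
      ← ENNReal.ofReal_mul (by positivity), inv_mul_cancel₀ ht.ne', ENNReal.ofReal_one]
  have hd : Dominated Ω t (((t⁻¹ : ℝ) : ℂ) • Y) := fun x y hx => by
    refine (h x y hx).trans_eq ?_
    rw [smul_apply, inner_smul_right, Complex.re_ofReal_mul]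
    field_simp
  exact ⟨_, hd.mem_admissible hpos hst, hd.objective_le ht.le hst.1⟩

end Domination

/-! ### Uniqueness of the minimizer -/

section Uniqueness

open scoped ENNReal

variable {E F : Type*}
  [NormedAddCommGroup E] [InnerProductSpace ℂ E] [CompleteSpace E]
  [NormedAddCommGroup F] [InnerProductSpace ℂ F] [CompleteSpace F]
  {Ω : HTensor E F →L[ℂ] HTensor E F}

/-- The parallelogram identity, with the nonnegative term at `y - z` dropped. -/
theorem re_inner_pureTensor_add_le
    (hpos : ∀ x y, 0 ≤ ⟪pureTensor x y, Ω (pureTensor x y)⟫_ℂ) (x : E) (y z : F) :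
    (⟪pureTensor x (y + z), Ω (pureTensor x (y + z))⟫_ℂ).re ≤
      2 * ((⟪pureTensor x y, Ω (pureTensor x y)⟫_ℂ).re +
        (⟪pureTensor x z, Ω (pureTensor x z)⟫_ℂ).re) := by
  have h := (Complex.nonneg_iff.1 (hpos x (y - z))).1
  simp only [pureTensor_add, pureTensor_sub, map_add, map_sub, inner_add_left, inner_add_right,
    inner_sub_left, inner_sub_right, Complex.add_re, Complex.sub_re] at h ⊢
  linarith

theorem re_inner_conj_expand {S : F →L[ℂ] F} (hS : S.IsPositive) (ε : ℝ) (x d : F) :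
    (⟪(1 / 2 : ℂ) • x + (ε : ℂ) • d, S ((1 / 2 : ℂ) • x + (ε : ℂ) • d)⟫_ℂ).re =
      (⟪x, S x⟫_ℂ).re / 4 + ε * (⟪d, S x⟫_ℂ).re + ε ^ 2 * (⟪d, S d⟫_ℂ).re := by
  have h1 : (⟪x, S d⟫_ℂ).re = (⟪d, S x⟫_ℂ).re := by
    rw [← hS.inner_left_eq_inner_right, ← inner_conj_symm, Complex.conj_re]
  simp only [map_add, map_smul, inner_add_left, inner_add_right, inner_smul_left, inner_smul_right]
  simp [h1]
  ring

/-- The dominating operators of minimal trace are unique. -/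
theorem eq_of_dominated (hpos : ∀ x y, 0 ≤ ⟪pureTensor x y, Ω (pureTensor x y)⟫_ℂ) {c : ℝ}
    (hc : 0 < c) {τ₀ τ₁ : F →L[ℂ] F} (h₀ : IsState τ₀) (h₁ : IsState τ₁) (d₀ : Dominated Ω c τ₀)
    (d₁ : Dominated Ω c τ₁)
    (hmin : ∀ Y : F →L[ℂ] F, Y.IsPositive → ptr Y ≠ ∞ → Dominated Ω 1 Y → c ≤ (ptr Y).toReal) :
    τ₀ = τ₁ := by
  rw [isState_iff] at h₀ h₁
  obtain ⟨p₀, t₀⟩ := h₀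
  obtain ⟨p₁, t₁⟩ := h₁
  set D := τ₀ - τ₁ with hD
  have hDsa : D.adjoint = D := by
    rw [hD, map_sub, p₀.isSelfAdjoint.adjoint_eq, p₁.isSelfAdjoint.adjoint_eq]
  -- `ε` is small enough for the quadratic term in `ε` to consume at most half of the linear gain
  -- below.
  obtain ⟨ε, hε, hε2⟩ : ∃ ε : ℝ, 0 < ε ∧ ε * ‖τ₀ + τ₁‖ ≤ 1 / 2 := by
    refine ⟨1 / (2 * (‖τ₀ + τ₁‖ + 1)), by positivity, ?_⟩
    rw [div_mul_eq_mul_div, div_le_div_iff₀ (by positivity) (by positivity)]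
    linarith
  let A : ℝ → F →L[ℂ] F := fun s => (1 / 2 : ℂ) • (1 : F →L[ℂ] F) + (s : ℂ) • D
  have hA : ∀ s x, A s x = (1 / 2 : ℂ) • x + (s : ℂ) • D x := fun s x => by simp [A]
  let Y : F →L[ℂ] F := ((2 * c : ℝ) : ℂ) •
    ((A (-ε)).adjoint ∘L τ₀ ∘L A (-ε) + (A ε).adjoint ∘L τ₁ ∘L A ε)
  have hYpos : Y.IsPositive :=
    ((p₀.adjoint_conj _).add (p₁.adjoint_conj _)).smul_of_nonneg
      (Complex.zero_le_real.2 (by positivity))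
  have hYx : ∀ x, (⟪x, Y x⟫_ℂ).re =
      2 * c * ((⟪A (-ε) x, τ₀ (A (-ε) x)⟫_ℂ).re + (⟪A ε x, τ₁ (A ε x)⟫_ℂ).re) := fun x => by
    simp only [Y, smul_apply, add_apply, ContinuousLinearMap.comp_apply, inner_smul_right,
      Complex.re_ofReal_mul, inner_add_right, ContinuousLinearMap.adjoint_inner_right,
      Complex.add_re]
  have hYdom : Dominated Ω 1 Y := fun x y hx => by
    -- The perturbations `∓ε D` of the two halves cancel, so `y` is split into parts bounded through
    -- `τ₀` and `τ₁` separately.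
    have hy : y = A (-ε) y + A ε y := by
      rw [hA, hA, Complex.ofReal_neg, neg_smul]
      module
    rw [one_mul, hYx]
    conv_lhs => rw [hy]
    refine (re_inner_pureTensor_add_le hpos _ _ _).trans ?_
    have := d₀ x (A (-ε) y) hx
    have := d₁ x (A ε y) hx
    linarith
  -- To order zero, `Y` is `c (τ₀ + τ₁) / 2`. The linear term is `-2cε ‖D x‖²`, since `D = τ₀ - τ₁`,
  -- and the quadratic one is at most `cε ‖D x‖²`. Taking traces, `Y` beats the minimal trace `c`
  -- unless `D = 0`.
  have hYle : ∀ x, (⟪x, Y x⟫_ℂ).re + c * ε * ‖D x‖ ^ 2 ≤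
      c / 2 * ((⟪x, τ₀ x⟫_ℂ).re + (⟪x, τ₁ x⟫_ℂ).re) := fun x => by
    rw [hYx, hA, hA, re_inner_conj_expand p₀, re_inner_conj_expand p₁]
    have e1 : (⟪D x, τ₀ x⟫_ℂ).re - (⟪D x, τ₁ x⟫_ℂ).re = ‖D x‖ ^ 2 := by
      rw [← Complex.sub_re, ← inner_sub_right, ← sub_apply, ← hD, inner_self_eq_norm_sq_to_K]
      simp [← Complex.ofReal_pow]
    have e2 : (⟪D x, τ₀ (D x)⟫_ℂ).re + (⟪D x, τ₁ (D x)⟫_ℂ).re ≤ ‖τ₀ + τ₁‖ * ‖D x‖ ^ 2 := by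
      rw [← Complex.add_re, ← inner_add_right, ← add_apply]
      exact (abs_le.1 (re_inner_le_opNorm _ _)).2
    have e3 : ε ^ 2 * ((⟪D x, τ₀ (D x)⟫_ℂ).re + (⟪D x, τ₁ (D x)⟫_ℂ).re) ≤
        ε * (1 / 2 * ‖D x‖ ^ 2) := by
      calc _ ≤ ε ^ 2 * (‖τ₀ + τ₁‖ * ‖D x‖ ^ 2) := by gcongr
        _ = ε * ((ε * ‖τ₀ + τ₁‖) * ‖D x‖ ^ 2) := by ring
        _ ≤ _ := by gcongr
    have e4 : (⟪D x, τ₀ x⟫_ℂ).re = ‖D x‖ ^ 2 + (⟪D x, τ₁ x⟫_ℂ).re := by linarith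
    rw [e4]
    nlinarith [mul_le_mul_of_nonneg_left e3 hc.le]
  have hq : ∀ x, qf Y x + ENNReal.ofReal (c * ε) * ‖D x‖ₑ ^ 2 ≤
      ENNReal.ofReal (c / 2) * (qf τ₀ x + qf τ₁ x) := fun x => by
    rw [qf, qf, qf, enorm_sq_eq_ofReal, ← ENNReal.ofReal_mul (by positivity),
      ← ENNReal.ofReal_add (re_inner_nonneg hYpos x) (by positivity),
      ← ENNReal.ofReal_add (re_inner_nonneg p₀ x) (re_inner_nonneg p₁ x),
      ← ENNReal.ofReal_mul (by positivity)]
    exact ENNReal.ofReal_le_ofReal (hYle x)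
  have hsum : ptr Y + ENNReal.ofReal (c * ε) * hs D ≤ ENNReal.ofReal c := by
    calc _ = ∑' i, (qf Y (fixedBasis F i) + ENNReal.ofReal (c * ε) * ‖D (fixedBasis F i)‖ₑ ^ 2) := by
          rw [ENNReal.tsum_add, ENNReal.tsum_mul_left]; rfl
      _ ≤ ∑' i, ENNReal.ofReal (c / 2) * (qf τ₀ (fixedBasis F i) + qf τ₁ (fixedBasis F i)) :=
          ENNReal.tsum_le_tsum fun i => hq _
      _ = ENNReal.ofReal (c / 2) * (ptr τ₀ + ptr τ₁) := by
          rw [ENNReal.tsum_mul_left, ENNReal.tsum_add]; rfl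
      _ = ENNReal.ofReal c := by
          rw [t₀, t₁, one_add_one_eq_two, ← ENNReal.ofReal_ofNat 2,
            ← ENNReal.ofReal_mul (by positivity)]
          congr 1; ring
  have hYfin : ptr Y ≠ ∞ := ne_top_of_le_ne_top ENNReal.ofReal_ne_top (le_self_add.trans hsum)
  have hle : ENNReal.ofReal c ≤ ptr Y := by
    rw [← ENNReal.ofReal_toReal hYfin]
    exact ENNReal.ofReal_le_ofReal (hmin Y hYpos hYfin hYdom)
  have h0 : ENNReal.ofReal (c * ε) * hs D = 0 := by
    have h1 : ptr Y + ENNReal.ofReal (c * ε) * hs D ≤ ptr Y + 0 := by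
      rw [add_zero]; exact hsum.trans hle
    exact le_antisymm ((ENNReal.add_le_add_iff_left hYfin).1 h1) bot_le
  have h2 : hs D = 0 := (mul_eq_zero.1 h0).resolve_left
    (ENNReal.ofReal_pos.2 (by positivity)).ne'
  have h3 : D = 0 := by simpa [h2] using enorm_sq_le_hs D
  exact sub_eq_zero.1 h3

end Uniqueness

/-! ### Devices built from finite families of vectors -/

section DeviceConstruction

open scoped ENNReal

variable {HA HA' HR : Type*}
  [NormedAddCommGroup HA] [InnerProductSpace ℂ HA] [CompleteSpace HA]
  [NormedAddCommGroup HA'] [InnerProductSpace ℂ HA'] [CompleteSpace HA']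
  [NormedAddCommGroup HR] [InnerProductSpace ℂ HR] [CompleteSpace HR]
  {T : Test HA HA' HR} {Ω : HTensor HA' HA →L[ℂ] HTensor HA' HA}

/-- Devices have outcomes indexed by `ℕ`; a finite list is padded with a default entry contributing
nothing. -/
theorem tsum_getD {α : Type*} (f : α → ℝ≥0∞) (l : List α) {d : α} (hd : f d = 0) :
    ∑' k, f (l.getD k d) = (l.map f).sum := by
  induction l with
  | nil => simp [hd]
  | cons a l ih =>
    rw [tsum_eq_zero_add' ENNReal.summable]
    simp only [List.getD_cons_zero, List.getD_cons_succ, List.map_cons, List.sum_cons, ih]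

theorem List.ofReal_sum_map {α : Type*} (f : α → ℝ) (hf : ∀ a, 0 ≤ f a) (l : List α) :
    ENNReal.ofReal (l.map f).sum = (l.map fun a => ENNReal.ofReal (f a)).sum := by
  induction l with
  | nil => simp
  | cons a l ih =>
    rw [List.map_cons, List.sum_cons, List.map_cons, List.sum_cons, ← ih, ENNReal.ofReal_add (hf a)]
    exact List.sum_nonneg (by simp only [List.mem_map]; rintro _ ⟨p, -, rfl⟩; exact hf p)

theorem le_one_of_qf_le {S : HA →L[ℂ] HA} (hS : S.IsPositive) (h : ∀ x, qf S x ≤ ‖x‖ₑ ^ 2) :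
    S ≤ 1 := by
  rw [ContinuousLinearMap.le_def, ContinuousLinearMap.isPositive_def']
  refine ⟨(IsSelfAdjoint.one _).sub hS.isSelfAdjoint, fun x => ?_⟩
  have h1 := h x
  rw [qf, enorm_sq_eq_ofReal, ENNReal.ofReal_le_ofReal_iff (by positivity)] at h1
  rw [ContinuousLinearMap.reApplyInnerSelf_apply, sub_apply, inner_sub_left, map_sub,
    hS.inner_left_eq_inner_right, one_apply_eq_self, inner_self_eq_norm_sq]
  exact sub_nonneg.2 h1

theorem qf_rankOne (φ x : HA) : qf (InnerProductSpace.rankOne ℂ φ φ) x = ‖⟪φ, x⟫_ℂ‖ₑ ^ 2 := by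
  rw [qf, InnerProductSpace.rankOne_apply, inner_smul_right, ← inner_conj_symm x φ,
    Complex.mul_conj', enorm_sq_eq_ofReal]
  simp [← Complex.ofReal_pow]

theorem adjoint_rankOne_self (φ : HA) :
    (InnerProductSpace.rankOne ℂ φ φ).adjoint = InnerProductSpace.rankOne ℂ φ φ :=
  (InnerProductSpace.isPositive_rankOne_self φ).isSelfAdjoint.adjoint_eq

/-- The square root of `|φ⟩⟨φ|`. -/
noncomputable def rankOneSqrt (φ : HA) : HA →L[ℂ] HA :=
  ((‖φ‖⁻¹ : ℝ) : ℂ) • InnerProductSpace.rankOne ℂ φ φ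

theorem adjoint_rankOneSqrt (φ : HA) : (rankOneSqrt φ).adjoint = rankOneSqrt φ := by
  rw [rankOneSqrt, LinearIsometryEquiv.map_smulₛₗ, adjoint_rankOne_self, Complex.conj_ofReal]

theorem rankOneSqrt_comp (φ : HA) :
    rankOneSqrt φ ∘L rankOneSqrt φ = InnerProductSpace.rankOne ℂ φ φ := by
  by_cases h : φ = 0
  · ext x; simp [rankOneSqrt, h]
  ext x
  simp only [rankOneSqrt, ContinuousLinearMap.comp_apply, smul_apply,
    InnerProductSpace.rankOne_apply, inner_smul_right, inner_self_eq_norm_sq_to_K, smul_smul]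
  congr 1
  have : (‖φ‖ : ℂ) ≠ 0 := by simpa using h
  push_cast
  field_simp
  simp [mul_comm]

theorem hs_normalized {x : HA} (hx : x ≠ 0) :
    ∑' i, ‖((‖x‖⁻¹ : ℝ) : ℂ) * ⟪x, fixedBasis HA i⟫_ℂ‖ₑ ^ 2 = 1 := by
  have h1 : ‖((‖x‖⁻¹ : ℝ) : ℂ) • x‖ₑ ^ 2 = 1 := by
    rw [enorm_sq_eq_ofReal, norm_smul]
    simp [hx]
  rw [← h1, parseval (fixedBasis HA)]
  refine tsum_congr fun i => ?_
  rw [inner_smul_right, ← enorm_norm, norm_mul, norm_inner_symm, ← norm_mul, enorm_norm]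

/-- Each vector `rankOneSqrt ψ eᵢ` is `⟪ψ, eᵢ⟫ / ‖ψ‖` times `ψ`, and by Parseval the squared moduli
of these coefficients sum to one. -/
theorem tsum_qf_rankOneSqrt (ψ : HA') (φ : HA) :
    ∑' i, ∑' j, qf Ω (pureTensor (rankOneSqrt ψ (fixedBasis HA' i))
      (rankOneSqrt φ (fixedBasis HA j))) = qf Ω (pureTensor ψ φ) := by
  by_cases hψ : ψ = 0
  · simp [hψ, rankOneSqrt, ← ketSnd_apply, qf]
  by_cases hφ : φ = 0
  · simp [hφ, rankOneSqrt, ← ketFst_apply, qf]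
  have e : ∀ i j, qf Ω (pureTensor (rankOneSqrt ψ (fixedBasis HA' i))
      (rankOneSqrt φ (fixedBasis HA j))) =
      ‖((‖ψ‖⁻¹ : ℝ) : ℂ) * ⟪ψ, fixedBasis HA' i⟫_ℂ‖ₑ ^ 2 *
      (‖((‖φ‖⁻¹ : ℝ) : ℂ) * ⟪φ, fixedBasis HA j⟫_ℂ‖ₑ ^ 2 * qf Ω (pureTensor ψ φ)) := fun i j => by
    simp only [rankOneSqrt, smul_apply, InnerProductSpace.rankOne_apply, smul_smul]
    rw [pureTensor_smul, qf_smul, enorm_mul, mul_pow, mul_assoc]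
  simp_rw [e, ENNReal.tsum_mul_left, ENNReal.tsum_mul_right, hs_normalized hψ, hs_normalized hφ,
    one_mul]

theorem isState_rankOne {ψ : HA} (hψ : ‖ψ‖ = 1) : IsState (InnerProductSpace.rankOne ℂ ψ ψ) := by
  refine isState_iff.2 ⟨InnerProductSpace.isPositive_rankOne_self ψ, ?_⟩
  simp_rw [ptr, qf_rankOne]
  calc _ = ‖ψ‖ₑ ^ 2 := by
        rw [parseval (fixedBasis HA)]
        refine tsum_congr fun i => ?_
        rw [← enorm_norm, norm_inner_symm, enorm_norm]
    _ = 1 := by rw [enorm_sq_eq_ofReal, hψ]; simp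

theorem ofReal_frameForm {Ψ : Type*} (l : List (Ψ × HA)) (x : HA) :
    ENNReal.ofReal (frameForm l x) =
      (l.map fun p => qf (InnerProductSpace.rankOne ℂ p.2 p.2) x).sum := by
  rw [frameForm, List.ofReal_sum_map _ (fun _ => by positivity)]
  simp_rw [qf_rankOne, enorm_sq_eq_ofReal]

/-- The expectation value of `Ω` on product vectors, as a function of a unit vector and a
vector. -/
noncomputable def expect (Ω : HTensor HA' HA →L[ℂ] HTensor HA' HA) (ψ : {x : HA' // ‖x‖ = 1})
    (φ : HA) : ℝ :=
  (⟪pureTensor ψ.1 φ, Ω (pureTensor ψ.1 φ)⟫_ℂ).re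

theorem expect_nonneg (hpos : ∀ x y, 0 ≤ ⟪pureTensor x y, Ω (pureTensor x y)⟫_ℂ)
    (ψ : {x : HA' // ‖x‖ = 1}) (φ : HA) : 0 ≤ expect Ω ψ φ := by
  have h := (Complex.nonneg_iff.1 (hpos ψ.1 φ)).1
  rwa [expect]

theorem ofReal_gain (hpos : ∀ x y, 0 ≤ ⟪pureTensor x y, Ω (pureTensor x y)⟫_ℂ)
    (l : List ({x : HA' // ‖x‖ = 1} × HA)) :
    ENNReal.ofReal (gain (expect Ω) l) = (l.map fun p => qf Ω (pureTensor p.1.1 p.2)).sum := by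
  rw [gain, List.ofReal_sum_map (fun p : {x : HA' // ‖x‖ = 1} × HA => expect Ω p.1 p.2)
    fun p => expect_nonneg hpos _ _]
  simp_rw [expect, qf]

theorem sum_le_one_of_tsum_qf_le {P : ℕ → HA →L[ℂ] HA} (hP : ∀ k, (P k).IsPositive)
    (h : ∀ x, ∑' k, qf (P k) x ≤ ‖x‖ₑ ^ 2) (s : Finset ℕ) : ∑ k ∈ s, P k ≤ 1 := by
  refine le_one_of_qf_le (ContinuousLinearMap.isPositive_sum s fun k _ => hP k) fun x => ?_
  have h1 : qf (∑ k ∈ s, P k) x = ∑ k ∈ s, qf (P k) x := by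
    simp_rw [qf]
    rw [← ENNReal.ofReal_sum_of_nonneg fun k _ => re_inner_nonneg (hP k) x, sum_apply, inner_sum,
      Complex.re_sum]
  rw [h1]
  exact (ENNReal.sum_le_tsum s).trans (h x)

theorem exists_measurePrepare {P Q : ℕ → HA →L[ℂ] HA} (hP : ∀ k, (P k).IsPositive)
    (h : ∀ x, ∑' k, qf (P k) x ≤ ‖x‖ₑ ^ 2) (hQ : ∀ k, (Q k).adjoint = Q k)
    (hQP : ∀ k, Q k ∘L Q k = P k) (χ : ℕ → {x : HA' // ‖x‖ = 1}) :
    ∃ C : MeasurePrepare HA HA', C.effect = P ∧ C.Roots Q fun k => rankOneSqrt (χ k).1 :=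
  ⟨⟨P, fun k => InnerProductSpace.rankOne ℂ (χ k).1 (χ k).1, hP, sum_le_one_of_tsum_qf_le hP h,
    fun k => isState_rankOne (χ k).2⟩, rfl,
    ⟨hQ, hQP, fun _ => adjoint_rankOneSqrt _, fun _ => rankOneSqrt_comp _⟩⟩

/-- The device that measures the effect `P` and the rank-one effects of the vectors of a family,
and prepares the labels of the family. -/
theorem exists_device (hΩ : T.IsPerformanceOperator Ω)
    (hpos : ∀ x y, 0 ≤ ⟪pureTensor x y, Ω (pureTensor x y)⟫_ℂ) {P : HA →L[ℂ] HA}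
    (hP : P.IsPositive) (ψ : {x : HA' // ‖x‖ = 1}) (l : List ({x : HA' // ‖x‖ = 1} × HA))
    (hle : ∀ x, qf P x + ENNReal.ofReal (frameForm l x) ≤ ‖x‖ₑ ^ 2)
    {S : HA →L[ℂ] HA} (hS : S.adjoint = S) (hSσ : S ∘L S = T.marginal) :
    ∃ C : MeasurePrepare HA HA', 0 ≤ T.succProb C ∧
      ENNReal.ofReal (T.succProb C) = ∑' j, (qf P (S (fixedBasis HA j)) +
        ENNReal.ofReal (frameForm l (S (fixedBasis HA j)))) ∧
      gain (expect Ω) l ≤ (tr (T.obs * C.applyFst T.state)).re := by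
  obtain ⟨Q, hQ, hQP⟩ := exists_sqrt hP
  -- Outcome `0` carries `P` and prepares `ψ`; outcome `k + 1` carries the `k`-th vector of the
  -- list. Past the end the vector is `0`, so the effect vanishes.
  let φ : ℕ → HA := fun k => (l.getD k (ψ, 0)).2
  let χ : ℕ → {x : HA' // ‖x‖ = 1} := fun k => Nat.casesOn k ψ fun k => (l.getD k (ψ, 0)).1
  let eff : ℕ → HA →L[ℂ] HA := fun k => Nat.casesOn k P fun k =>
    InnerProductSpace.rankOne ℂ (φ k) (φ k)
  let root : ℕ → HA →L[ℂ] HA := fun k => Nat.casesOn k Q fun k => rankOneSqrt (φ k)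
  have heffpos : ∀ k, (eff k).IsPositive := fun k => by
    cases k with
    | zero => exact hP
    | succ k => exact InnerProductSpace.isPositive_rankOne_self _
  have hqf : ∀ x, ∑' k, qf (eff k) x = qf P x + ENNReal.ofReal (frameForm l x) := fun x => by
    rw [tsum_eq_zero_add' ENNReal.summable, ofReal_frameForm]
    congr 1
    have := tsum_getD (fun p : {x : HA' // ‖x‖ = 1} × HA =>
      qf (InnerProductSpace.rankOne ℂ p.2 p.2) x) l (d := (ψ, 0)) (by simp [qf])
    rw [← this]
  obtain ⟨C, hC, hroots⟩ := exists_measurePrepare (Q := root) heffpos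
    (fun x => (hqf x).trans_le (hle x))
    (fun k => by
      cases k with
      | zero => exact hQ
      | succ k => exact adjoint_rankOneSqrt _)
    (fun k => by
      cases k with
      | zero => exact hQP
      | succ k => exact rankOneSqrt_comp _) χ
  obtain ⟨hs0, hs1⟩ := T.succProb_eq hroots
  obtain ⟨hn0, hn1⟩ := Test.tr_obs_applyFst hΩ hpos hroots
  refine ⟨C, hs0, ?_, ?_⟩
  · rw [hs1, ← hSσ]
    simp_rw [fun k => tsum_qf_comm (hroots.adjoint_effect k) hS, hroots.effect_eq, hC]
    rw [ENNReal.tsum_comm]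
    exact tsum_congr fun j => hqf _
  · refine (ENNReal.ofReal_le_ofReal_iff hn0).1 ?_
    -- The contribution of outcome `0` is nonnegative and is discarded.
    rw [hn1, tsum_eq_zero_add' ENNReal.summable]
    refine le_trans (le_of_eq ?_) le_add_self
    rw [ofReal_gain hpos]
    have := tsum_getD (fun p : {x : HA' // ‖x‖ = 1} × HA => qf Ω (pureTensor p.1.1 p.2)) l
      (d := (ψ, 0)) (by simp [qf, ← ketFst_apply])
    rw [← show _ = _ from this]
    refine tsum_congr fun k => ?_
    exact (tsum_qf_rankOneSqrt _ _).symm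

end DeviceConstruction

/-! ### Weak and strong duality for the benchmarks -/

section Benchmarks

open scoped ENNReal

variable {HA HA' HR : Type*}
  [NormedAddCommGroup HA] [InnerProductSpace ℂ HA] [CompleteSpace HA]
  [NormedAddCommGroup HA'] [InnerProductSpace ℂ HA'] [CompleteSpace HA']
  [NormedAddCommGroup HR] [InnerProductSpace ℂ HR] [CompleteSpace HR]
  {T : Test HA HA' HR} {Ω : HTensor HA' HA →L[ℂ] HTensor HA' HA}

theorem exists_unit_of_device (C : MeasurePrepare HA HA') : ∃ ψ : HA', ‖ψ‖ = 1 := by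
  obtain ⟨φ, hφ⟩ := (C.prep_state 0).exists_apply_ne_zero
  exact ⟨(‖C.prep 0 φ‖⁻¹ : ℂ) • C.prep 0 φ, by simp [norm_smul, hφ]⟩

theorem exists_unit_of_ne_zero (hΩ : Ω ≠ 0) : ∃ ψ : HA', ‖ψ‖ = 1 := by
  by_contra! h
  refine hΩ (ext_pureTensor fun x y => ?_)
  have hx : x = 0 := by
    by_contra hx
    exact h ((‖x‖⁻¹ : ℂ) • x) (by simp [norm_smul, hx])
  simp [hx, ← ketSnd_apply]

/-- The total contribution of a device is bounded by any operator dominating the performance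
operator. -/
theorem tr_obs_applyFst_le (hΩ : T.IsPerformanceOperator Ω)
    (hpos : ∀ x y, 0 ≤ ⟪pureTensor x y, Ω (pureTensor x y)⟫_ℂ) {C : MeasurePrepare HA HA'} {Q R}
    (h : C.Roots Q R) {c : ℝ} (hc : 0 ≤ c) {τ : HA →L[ℂ] HA} (hdom : Dominated Ω c τ) :
    ENNReal.ofReal (tr (T.obs * C.applyFst T.state)).re ≤
      ENNReal.ofReal c * ∑' k, ∑' j, qf τ (Q k (fixedBasis HA j)) := by
  have hq : ∀ x y, qf Ω (pureTensor x y) ≤ ‖x‖ₑ ^ 2 * (ENNReal.ofReal c * qf τ y) := fun x y => by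
    rw [qf, qf, enorm_sq_eq_ofReal, ← ENNReal.ofReal_mul hc, ← ENNReal.ofReal_mul (by positivity)]
    exact ENNReal.ofReal_le_ofReal (re_inner_pureTensor_le hdom x y)
  rw [(Test.tr_obs_applyFst hΩ hpos h).2, ← ENNReal.tsum_mul_left]
  refine ENNReal.tsum_le_tsum fun k => ?_
  calc _ ≤ ∑' i, ∑' j, ‖R k (fixedBasis HA' i)‖ₑ ^ 2 *
        (ENNReal.ofReal c * qf τ (Q k (fixedBasis HA j))) :=
        ENNReal.tsum_le_tsum fun i => ENNReal.tsum_le_tsum fun j => hq _ _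
    _ = hs (R k) * (ENNReal.ofReal c * ∑' j, qf τ (Q k (fixedBasis HA j))) := by
        simp_rw [ENNReal.tsum_mul_left, ENNReal.tsum_mul_right]; rfl
    _ = _ := by rw [h.hs_prep, one_mul]

/-- The marginal input state dominates the performance operator. -/
theorem exists_dominated_marginal (hΩ : T.IsPerformanceOperator Ω) :
    ∃ c : ℝ, 0 ≤ c ∧ Dominated Ω c T.marginal := by
  -- The constant comes from `enorm_tr_mul_le` applied to `Tr[⟨x|O|x⟩ ⟨y|σ|y⟩]`, because the second
  -- factor has trace `⟪y, σ_A y⟫`.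
  refine ⟨‖T.obs‖ ^ 2 + 1, by positivity, fun x y hx => ?_⟩
  obtain ⟨hm, -, hm2⟩ := traceSnd_spec T.isState_state.1 (by simp [T.ptr_state])
  have hfin : ptr (block T.state y y) ≠ ∞ := by rw [hm2]; exact qf_ne_top _ _
  have h1 := enorm_tr_mul_le (block_isPositive T.isState_state.1 y) (block T.obs x x) hfin
  rw [← hΩ, hm2] at h1
  have hket : ‖ketFst (F := HR) x‖ ≤ 1 := by
    refine ContinuousLinearMap.opNorm_le_bound _ zero_le_one fun z => ?_
    rw [ketFst_apply, norm_pureTensor, hx]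
  have hb : ‖block T.obs x x‖ ≤ ‖T.obs‖ := by
    calc _ ≤ ‖(ketFst (F := HR) x).adjoint‖ * (‖T.obs‖ * ‖ketFst (F := HR) x‖) :=
          (ContinuousLinearMap.opNorm_comp_le _ _).trans
            (by gcongr; exact ContinuousLinearMap.opNorm_comp_le _ _)
      _ ≤ 1 * (‖T.obs‖ * 1) := by
          gcongr
          rwa [LinearIsometryEquiv.norm_map]
      _ = _ := by ring
  have h2 : ENNReal.ofReal (⟪pureTensor x y, Ω (pureTensor x y)⟫_ℂ).re ≤
      ENNReal.ofReal ((‖T.obs‖ ^ 2 + 1) * (⟪y, T.marginal y⟫_ℂ).re) := by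
    calc _ ≤ ‖⟪pureTensor x y, Ω (pureTensor x y)⟫_ℂ‖ₑ := by
          rw [← ofReal_norm]
          exact ENNReal.ofReal_le_ofReal (Complex.re_le_norm _)
      _ ≤ _ := h1
      _ ≤ _ := by
          rw [enorm_sq_eq_ofReal, ← ENNReal.ofReal_one,
            ← ENNReal.ofReal_add (by positivity) zero_le_one, ENNReal.ofReal_mul (by positivity)]
          refine mul_le_mul' (ENNReal.ofReal_le_ofReal ?_) le_rfl
          gcongr
  exact (ENNReal.ofReal_le_ofReal_iff
    (mul_nonneg (by positivity) (re_inner_nonneg hm y))).1 h2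

theorem succProb_le_one (T : Test HA HA' HR) (C : MeasurePrepare HA HA') : T.succProb C ≤ 1 := by
  obtain ⟨Q, R, h⟩ := C.exists_roots
  have hm := isState_iff.1 T.marginal_isState
  have h1 := tsum_effect_le h.adjoint_effect h.effect_eq C.effect_pos C.effect_sum_le hm.1
  rw [← (T.succProb_eq h).2, hm.2] at h1
  simpa using h1

theorem le_benchmark {C : MeasurePrepare HA HA'} {p : ℝ} (h : T.succProb C = p) :
    (T.score C : EReal) ≤ T.benchmark p :=
  le_iSup_of_le C (le_iSup_of_le h le_rfl)

/-- A nonnegative extended real objective value that is finite is a real number. -/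
theorem objective_cases (hpos : ∀ x y, 0 ≤ ⟪pureTensor x y, Ω (pureTensor x y)⟫_ℂ)
    {τ : HA →L[ℂ] HA} (hτ : IsState τ) {ψ : HA'} (hψ : ‖ψ‖ = 1) :
    objective Ω τ = ⊤ ∨ ∃ c : ℝ, 0 ≤ c ∧ objective Ω τ = c := by
  have h0 := objective_nonneg hpos hτ hψ
  induction h : objective Ω τ using EReal.rec with
  | bot => simp [h] at h0
  | top => exact Or.inl rfl
  | coe c => exact Or.inr ⟨c, by rw [h] at h0; exact_mod_cast h0, rfl⟩

/-- Weak duality: at success probability one the score is its numerator, which is at most `c ∑ₖ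
Tr[Pₖ τ] ≤ c` for every dominating state `τ`. -/
theorem benchmark_one_le_objective (hΩ : T.IsPerformanceOperator Ω)
    (hpos : ∀ x y, 0 ≤ ⟪pureTensor x y, Ω (pureTensor x y)⟫_ℂ) {τ : HA →L[ℂ] HA}
    (hτ : τ ∈ admissible Ω) : T.benchmark 1 ≤ objective Ω τ := by
  refine iSup_le fun C => iSup_le fun hC => ?_
  obtain ⟨ψ, hψ⟩ := exists_unit_of_device C
  obtain h | ⟨c, hc, h⟩ := objective_cases hpos hτ.1 hψ
  · simp [h]
  obtain ⟨Q, R, hroots⟩ := C.exists_roots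
  have h1 := tr_obs_applyFst_le hΩ hpos hroots hc (dominated_of_objective_le hpos hτ h.le)
  have h2 := tsum_effect_le hroots.adjoint_effect hroots.effect_eq C.effect_pos C.effect_sum_le
    hτ.1.1
  rw [(isState_iff.1 hτ.1).2] at h2
  have h3 := h1.trans (mul_le_mul_right h2 _)
  rw [mul_one, ENNReal.ofReal_le_ofReal_iff hc] at h3
  rw [h, Test.score, hC, div_one]
  exact_mod_cast h3

/-- For `τ = σ_A` the sum `∑ₖ Tr[Pₖ τ]` is the success probability itself, which cancels the
denominator for every `p`. -/
theorem benchmark_le_of_dominated (hΩ : T.IsPerformanceOperator Ω)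
    (hpos : ∀ x y, 0 ≤ ⟪pureTensor x y, Ω (pureTensor x y)⟫_ℂ) {c : ℝ} (hc : 0 ≤ c)
    (h : Dominated Ω c T.marginal) {p : ℝ} (hp : 0 < p) : T.benchmark p ≤ c := by
  refine iSup_le fun C => iSup_le fun hC => ?_
  obtain ⟨Q, R, hroots⟩ := C.exists_roots
  have h1 := tr_obs_applyFst_le hΩ hpos hroots hc h
  rw [← (T.succProb_eq hroots).2, hC, ← ENNReal.ofReal_mul hc,
    ENNReal.ofReal_le_ofReal_iff (by positivity)] at h1
  rw [EReal.coe_le_coe_iff, Test.score, hC, div_le_iff₀ hp]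
  exact h1

theorem marginal_mem_admissible (hΩ : T.IsPerformanceOperator Ω)
    (hpos : ∀ x y, 0 ≤ ⟪pureTensor x y, Ω (pureTensor x y)⟫_ℂ) : T.marginal ∈ admissible Ω := by
  obtain ⟨c, -, h⟩ := exists_dominated_marginal hΩ
  exact h.mem_admissible hpos T.marginal_isState

theorem exists_objective_marginal_eq (hΩ : T.IsPerformanceOperator Ω)
    (hpos : ∀ x y, 0 ≤ ⟪pureTensor x y, Ω (pureTensor x y)⟫_ℂ) {ψ : HA'} (hψ : ‖ψ‖ = 1) :
    ∃ c : ℝ, 0 ≤ c ∧ objective Ω T.marginal = c := by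
  refine (objective_cases hpos T.marginal_isState hψ).resolve_left fun h => ?_
  obtain ⟨c, hc, hd⟩ := exists_dominated_marginal hΩ
  have := hd.objective_le hc T.marginal_isState.1
  rw [h] at this
  exact absurd this (by simp)

theorem frameForm_eq_re_inner {Ψ : Type*} (l : List (Ψ × HA)) (x : HA) :
    frameForm l x =
      (⟪x, (l.map fun p => InnerProductSpace.rankOne ℂ p.2 p.2).sum x⟫_ℂ).re := by
  induction l with
  | nil => simp [frameForm]
  | cons a l ih =>
    have h : ‖⟪a.2, x⟫_ℂ‖ ^ 2 = (⟪x, InnerProductSpace.rankOne ℂ a.2 a.2 x⟫_ℂ).re := by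
      rw [InnerProductSpace.rankOne_apply, inner_smul_right, ← inner_conj_symm x a.2,
        Complex.mul_conj']
      simp [← Complex.ofReal_pow]
    rw [List.map_cons, List.sum_cons, add_apply, inner_add_right, Complex.add_re, ← ih, ← h]
    simp [frameForm]

theorem isSelfAdjoint_sum_rankOne {Ψ : Type*} (l : List (Ψ × HA)) :
    IsSelfAdjoint (l.map fun p => InnerProductSpace.rankOne ℂ p.2 p.2).sum := by
  induction l with
  | nil => exact .zero _
  | cons a l ih =>
    rw [List.map_cons, List.sum_cons]
    exact (InnerProductSpace.isPositive_rankOne_self a.2).isSelfAdjoint.add ih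

theorem expect_smul (ψ : {x : HA' // ‖x‖ = 1}) (c : ℝ) (φ : HA) (_ : 0 ≤ c) :
    expect Ω ψ ((c : ℂ) • φ) = c ^ 2 * expect Ω ψ φ := by
  rw [expect, expect, ← ketFst_apply, map_smul, map_smul, inner_smul_left, inner_smul_right,
    Complex.conj_ofReal, ← mul_assoc, ← Complex.ofReal_mul, Complex.re_ofReal_mul, ketFst_apply, sq]

/-- Completing a subnormalized family to a measurement and scaling it gives devices with any
success probability. -/
theorem gain_le_benchmark (hΩ : T.IsPerformanceOperator Ω)
    (hpos : ∀ x y, 0 ≤ ⟪pureTensor x y, Ω (pureTensor x y)⟫_ℂ) (ψ : {x : HA' // ‖x‖ = 1})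
    {p : ℝ} (hp : 0 < p) (hp1 : p ≤ 1) {l : List ({x : HA' // ‖x‖ = 1} × HA)}
    (hl : ∀ x, frameForm l x ≤ ‖x‖ ^ 2) : (gain (expect Ω) l : EReal) ≤ T.benchmark p := by
  obtain ⟨S, hS, hSσ⟩ := exists_sqrt T.marginal_isState.1
  set G : HA →L[ℂ] HA := (l.map fun p => InnerProductSpace.rankOne ℂ p.2 p.2).sum with hG
  have hGsa : IsSelfAdjoint G := by
    exact isSelfAdjoint_sum_rankOne l
  have hre : ∀ x, (⟪x, (1 - G) x⟫_ℂ).re = ‖x‖ ^ 2 - frameForm l x := fun x => by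
    rw [sub_apply, one_apply_eq_self, inner_sub_right, Complex.sub_re, frameForm_eq_re_inner,
      inner_self_eq_norm_sq_to_K]
    simp [← Complex.ofReal_pow, hG]
  have hPpos : (1 - G).IsPositive := by
    rw [ContinuousLinearMap.isPositive_def']
    refine ⟨(IsSelfAdjoint.one _).sub hGsa, fun x => ?_⟩
    rw [ContinuousLinearMap.reApplyInnerSelf_apply, ← inner_conj_symm]
    simp only [RCLike.re_to_complex, Complex.conj_re, hre]
    linarith [hl x]
  -- Adding `p (1 - G)` to the family scaled by `√p` gives total effect exactly `p I`, hence success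
  -- probability `p`.
  have hsum : ∀ x, qf ((p : ℂ) • (1 - G)) x + ENNReal.ofReal (frameForm (scaleFamily √p l) x) =
      ENNReal.ofReal p * ‖x‖ₑ ^ 2 := fun x => by
    rw [qf_smul_op hp.le, qf, hre, frameForm_scale, Real.sq_sqrt hp.le, enorm_sq_eq_ofReal,
      ENNReal.ofReal_mul hp.le, ← mul_add, ← ENNReal.ofReal_add (by linarith [hl x])
      (frameForm_nonneg _ _), sub_add_cancel]
  obtain ⟨C, hC0, hC1, hC2⟩ := exists_device hΩ hpos
    (hPpos.smul_of_nonneg (Complex.zero_le_real.2 hp.le)) ψ (scaleFamily √p l)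
    (fun x => (hsum x).trans_le (mul_le_of_le_one_left' (by simpa using hp1))) hS hSσ
  have hsucc : T.succProb C = p := by
    simp_rw [hsum, ENNReal.tsum_mul_left] at hC1
    have hS1 : hs S = 1 := by
      rw [← ptr_sqrt hS, hSσ]; exact (isState_iff.1 T.marginal_isState).2
    rw [← hs, hS1, mul_one] at hC1
    exact (ENNReal.ofReal_eq_ofReal_iff hC0 hp.le).1 hC1
  refine le_trans ?_ (le_benchmark hsucc)
  rw [EReal.coe_le_coe_iff, Test.score, hsucc, le_div_iff₀ hp]
  rwa [gain_scale expect_smul (by positivity), Real.sq_sqrt hp.le, mul_comm] at hC2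

/-- The rank-one devices show that the objective at the marginal input state is at most the
largest benchmark. -/
theorem objective_marginal_le (hΩ : T.IsPerformanceOperator Ω)
    (hpos : ∀ x y, 0 ≤ ⟪pureTensor x y, Ω (pureTensor x y)⟫_ℂ) {b : EReal}
    (hb : ∀ p ∈ Set.Ioc (0 : ℝ) 1, T.benchmark p ≤ b) : objective Ω T.marginal ≤ b := by
  refine iSup_le fun x => iSup_le fun α => iSup_le fun hx => iSup_le fun hα => ?_
  have hm := T.marginal_isState
  obtain ⟨hS, hSσ⟩ := sqrt_spec hm.1
  set S := CFC.sqrt T.marginal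
  have hle : ‖S (invSqrt T.marginal α)‖ ≤ 1 := (norm_sqrt_invSqrt_le hm.1 α).trans_eq hα
  have hker : T.marginal (invSqrt T.marginal α) = 0 → Ω (pureTensor x (invSqrt T.marginal α)) = 0 :=
    fun h => mem_admissible_apply_eq_zero (marginal_mem_admissible hΩ hpos) h x
  generalize invSqrt T.marginal α = y at *
  -- If `S y = 0`, admissibility makes the term vanish, and the empty family shows that the
  -- benchmark at `1` is nonnegative.
  by_cases h0 : S y = 0
  · rw [hker (by rw [← hSσ]; simp [h0])]
    refine le_trans ?_ (hb 1 (by simp))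
    have := gain_le_benchmark (l := []) hΩ hpos ⟨x, hx⟩ one_pos le_rfl (by simp [frameForm])
    simpa [gain] using this
  have hy : y ≠ 0 := fun h => h0 (by simp [h])
  have hyn : 0 < ‖y‖ := norm_pos_iff.2 hy
  have hframe : ∀ z, frameForm [((⟨x, hx⟩ : {x : HA' // ‖x‖ = 1}), ((‖y‖⁻¹ : ℝ) : ℂ) • y)] z =
      (‖y‖⁻¹) ^ 2 * ‖⟪y, z⟫_ℂ‖ ^ 2 := fun z => by
    simp only [frameForm, List.map_cons, List.map_nil, List.sum_cons, List.sum_nil, add_zero]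
    rw [inner_smul_left, norm_mul, mul_pow]
    simp
  -- The device tests for `y / ‖y‖` and prepares `x`. It succeeds with probability `‖S y‖² / ‖y‖²`,
  -- so its score is at least the expectation of `Ω` at `x ⊗ y` divided by `‖S y‖² ≤ 1`.
  obtain ⟨C, hC0, hC1, hC2⟩ := exists_device hΩ hpos ContinuousLinearMap.isPositive_zero
    (⟨x, hx⟩ : {x : HA' // ‖x‖ = 1}) [(⟨x, hx⟩, ((‖y‖⁻¹ : ℝ) : ℂ) • y)] (fun z => by
      rw [hframe, enorm_sq_eq_ofReal]
      simp only [qf, zero_apply, inner_zero_right, Complex.zero_re, ENNReal.ofReal_zero, zero_add]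
      refine ENNReal.ofReal_le_ofReal ?_
      have := norm_inner_le_norm (𝕜 := ℂ) y z
      calc _ ≤ (‖y‖⁻¹) ^ 2 * (‖y‖ * ‖z‖) ^ 2 := by gcongr
        _ = _ := by field_simp) hS hSσ
  have hsucc : T.succProb C = (‖y‖⁻¹) ^ 2 * ‖S y‖ ^ 2 := by
    refine (ENNReal.ofReal_eq_ofReal_iff hC0 (by positivity)).1 (hC1.trans ?_)
    simp_rw [hframe]
    simp only [qf, zero_apply, inner_zero_right, Complex.zero_re, ENNReal.ofReal_zero, zero_add]
    rw [ENNReal.ofReal_mul (by positivity), ← enorm_sq_eq_ofReal (S y), parseval (fixedBasis HA),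
      ← ENNReal.tsum_mul_left]
    refine tsum_congr fun i => ?_
    rw [ENNReal.ofReal_mul (by positivity), ← enorm_sq_eq_ofReal]
    congr 2
    rw [← ContinuousLinearMap.adjoint_inner_left, hS, ← enorm_norm, norm_inner_symm, enorm_norm]
  have hp : 0 < T.succProb C := by
    rw [hsucc]
    have : 0 < ‖S y‖ := norm_pos_iff.2 h0
    positivity
  refine le_trans ?_ ((le_benchmark rfl).trans (hb _ ⟨hp, succProb_le_one T C⟩))
  rw [EReal.coe_le_coe_iff, Test.score, le_div_iff₀ hp]
  refine le_trans ?_ hC2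
  simp only [gain, List.map_cons, List.map_nil, List.sum_cons, List.sum_nil, add_zero]
  rw [expect_smul _ _ _ (by positivity), hsucc, expect]
  have h1 := (Complex.nonneg_iff.1 (hpos x y)).1
  have h2 : ‖S y‖ ^ 2 ≤ 1 := pow_le_one₀ (norm_nonneg _) hle
  calc _ ≤ (⟪pureTensor x y, Ω (pureTensor x y)⟫_ℂ).re * ((‖y‖⁻¹) ^ 2 * 1) := by gcongr
    _ = _ := by ring

/-- Strong duality: every benchmark is attained as an upper bound of the objective at some
admissible state. -/
theorem exists_objective_le_benchmark (hΩ : T.IsPerformanceOperator Ω)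
    (hpos : ∀ x y, 0 ≤ ⟪pureTensor x y, Ω (pureTensor x y)⟫_ℂ) (h0 : Ω ≠ 0) {p : ℝ} (hp : 0 < p)
    (hp1 : p ≤ 1) : ∃ τ ∈ admissible Ω, objective Ω τ ≤ T.benchmark p := by
  obtain ⟨ψ, hψ⟩ := exists_unit_of_ne_zero h0
  obtain ⟨c, hc, hd⟩ := exists_dominated_marginal hΩ
  have hle := benchmark_le_of_dominated hΩ hpos hc hd hp
  have hge := fun l hl => gain_le_benchmark (l := l) hΩ hpos ⟨ψ, hψ⟩ hp hp1 hl
  have h0' : (0 : EReal) ≤ T.benchmark p := by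
    simpa [gain] using hge [] (by simp [frameForm])
  obtain ⟨B, hB⟩ : ∃ B : ℝ, T.benchmark p = B :=
    ⟨_, (EReal.coe_toReal (ne_top_of_le_ne_top (EReal.coe_ne_top c) hle)
      (ne_bot_of_le_ne_bot EReal.zero_ne_bot h0')).symm⟩
  rw [hB] at hge h0' ⊢
  have hB0 : 0 ≤ B := by exact_mod_cast h0'
  -- The gain of every subnormalized family is at most `B = T.benchmark p`, which is the hypothesis
  -- of the duality lemma.
  obtain ⟨Y, hY, hYB, hYh⟩ := exists_dominating_operator (h := expect Ω) expect_smul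
    (fun l hl => EReal.coe_le_coe_iff.1 (hge l hl))
  obtain ⟨τ, hτ, hτle⟩ := exists_admissible_of_dominated hpos h0 hY
    (ne_top_of_le_ne_top ENNReal.ofReal_ne_top hYB) (fun x y hx => by
      rw [one_mul]; exact hYh ⟨x, hx⟩ y)
  refine ⟨τ, hτ, hτle.trans (EReal.coe_le_coe_iff.2 ?_)⟩
  exact ENNReal.toReal_le_of_le_ofReal hB0 hYB

/-- Both minimizers dominate `Ω` with constant the minimal value `c`, and `c > 0` since `Ω ≠ 0`. Any
dominating operator has trace at least `c`, because normalizing it gives an admissible state. -/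
theorem isMinimizer_unique (hΩ : T.IsPerformanceOperator Ω)
    (hpos : ∀ x y, 0 ≤ ⟪pureTensor x y, Ω (pureTensor x y)⟫_ℂ) (h0 : Ω ≠ 0) {τ₀ τ₁ : HA →L[ℂ] HA}
    (h₀ : IsMinimizer Ω τ₀) (h₁ : IsMinimizer Ω τ₁) : τ₀ = τ₁ := by
  obtain ⟨ψ, hψ⟩ := exists_unit_of_ne_zero h0
  obtain ⟨c', -, hc'⟩ := exists_objective_marginal_eq hΩ hpos hψ
  have hfin : objective Ω τ₀ ≠ ⊤ := ne_top_of_le_ne_top (EReal.coe_ne_top c')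
    ((h₀.2 _ (marginal_mem_admissible hΩ hpos)).trans_eq hc')
  obtain ⟨c, hc, hobj⟩ := (objective_cases hpos h₀.1.1 hψ).resolve_left hfin
  have d₀ := dominated_of_objective_le hpos h₀.1 hobj.le
  have d₁ := dominated_of_objective_le hpos h₁.1 ((h₁.2 _ h₀.1).trans hobj.le)
  have hcpos : 0 < c := hc.lt_of_ne' fun h => h0 (by subst h; exact d₀.eq_zero hpos)
  refine eq_of_dominated hpos hcpos h₀.1.1 h₁.1.1 d₀ d₁ fun Y hY hYfin hYd => ?_
  obtain ⟨τ, hτ, hτle⟩ := exists_admissible_of_dominated hpos h0 hY hYfin hYd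
  have := (h₀.2 τ hτ).trans hτle
  rw [hobj] at this
  exact EReal.coe_le_coe_iff.1 this

theorem benchmark_le_objective_marginal (hΩ : T.IsPerformanceOperator Ω)
    (hpos : ∀ x y, 0 ≤ ⟪pureTensor x y, Ω (pureTensor x y)⟫_ℂ) {p : ℝ} (hp : 0 < p) :
    T.benchmark p ≤ objective Ω T.marginal := by
  by_cases hne : ∃ ψ : HA', ‖ψ‖ = 1
  · obtain ⟨ψ, hψ⟩ := hne
    obtain ⟨c, hc, hobj⟩ := exists_objective_marginal_eq hΩ hpos hψ
    rw [hobj]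
    exact benchmark_le_of_dominated hΩ hpos hc
      (dominated_of_objective_le hpos (marginal_mem_admissible hΩ hpos) hobj.le) hp
  -- Without unit vectors in the output space there are no states to prepare, hence no devices, and
  -- the benchmark is `⊥`.
  · exact iSup_le fun C => absurd (exists_unit_of_device C) hne

theorem objective_le_benchmark_of_isMinimizer (hΩ : T.IsPerformanceOperator Ω)
    (hpos : ∀ x y, 0 ≤ ⟪pureTensor x y, Ω (pureTensor x y)⟫_ℂ) (h : IsMinimizer Ω T.marginal)
    {p : ℝ} (hp : 0 < p) (hp1 : p ≤ 1) : objective Ω T.marginal ≤ T.benchmark p := by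
  -- For `Ω = 0` no dominating operator can be normalized; the objective is then at most `0`, below
  -- the gain of the empty family.
  by_cases h0 : Ω = 0
  · refine iSup_le fun x => iSup_le fun α => iSup_le fun hx => iSup_le fun _ => ?_
    have := gain_le_benchmark (l := []) hΩ hpos ⟨x, hx⟩ hp hp1 (by simp [frameForm])
    simpa [gain, h0] using this
  · obtain ⟨τ, hτ, hle⟩ := exists_objective_le_benchmark hΩ hpos h0 hp hp1
    exact (h.2 τ hτ).trans hle

end Benchmarks

end QBench

/-! ### The black-box criterion and the unique minimizer -/

theorem corollary1
    {HA HA' HR : Type*}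
    [NormedAddCommGroup HA] [InnerProductSpace ℂ HA] [CompleteSpace HA]
    [NormedAddCommGroup HA'] [InnerProductSpace ℂ HA'] [CompleteSpace HA']
    [NormedAddCommGroup HR] [InnerProductSpace ℂ HR] [CompleteSpace HR]
    (T : QBench.Test HA HA' HR)
    (Ω : QBench.HTensor HA' HA →L[ℂ] QBench.HTensor HA' HA)
    (hΩ : T.IsPerformanceOperator Ω) (hPPT : QBench.IsPPT Ω) :
    (T.FullyBlackBox ↔ QBench.IsMinimizer Ω T.marginal) ∧
      (Ω ≠ 0 → ∃! τ : HA →L[ℂ] HA, QBench.IsMinimizer Ω τ) := by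
  have hpos := hPPT.inner_nonneg
  refine ⟨⟨fun h => ⟨QBench.marginal_mem_admissible hΩ hpos, fun τ hτ => ?_⟩,
    fun h p hp q hq => ?_⟩, fun h0 => ?_⟩
  -- A constant benchmark makes `b(1)` a common upper bound, so `f(σ_A) ≤ b(1) ≤ f(τ)`.
  · exact (QBench.objective_marginal_le hΩ hpos fun p hp => (h p hp 1 (by simp)).le).trans
      (QBench.benchmark_one_le_objective hΩ hpos hτ)
  -- For a minimizing marginal, `b(p) ≤ f(σ_A) ≤ b(q)` for all `p` and `q`.
  · exact le_antisymm
      ((QBench.benchmark_le_objective_marginal hΩ hpos hp.1).trans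
        (QBench.objective_le_benchmark_of_isMinimizer hΩ hpos h hq.1 hq.2))
      ((QBench.benchmark_le_objective_marginal hΩ hpos hq.1).trans
        (QBench.objective_le_benchmark_of_isMinimizer hΩ hpos h hp.1 hp.2))
  -- The state obtained from duality at `p = 1` has `f(τ) ≤ b(1)`, and `b(1)` is a lower bound of
  -- `f`.
  · obtain ⟨τ, hτ, hle⟩ := QBench.exists_objective_le_benchmark hΩ hpos h0 one_pos le_rfl
    have hmin : QBench.IsMinimizer Ω τ :=
      ⟨hτ, fun τ' hτ' => hle.trans (QBench.benchmark_one_le_objective hΩ hpos hτ')⟩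
    exact ⟨τ, hmin, fun τ' h' => QBench.isMinimizer_unique hΩ hpos h0 h' hmin⟩
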